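/- Let $\pi:X\to S$ be a proper smooth morphism of complex analytic spaces (for instance, a proper holomorphic submersion of complex manifolds) with non-empty connected fibres. Let $T_X,T_S$ be the sheaves of $\mathbb C$-derivations of $\mathcal O_X,\mathcal O_S$, let $p:T_X\to\pi^*T_S$ be the projection, which sends a derivation $D$ to its composite with $\pi^{-1}\mathcal O_S\to\mathcal O_X$, and let $\pi^{-1}T_S\subset\pi^*T_S$ be the subsheaf of sections that are locally pullbacks of vector fields on $S$. Let $A_S$ be a family of Lie algebroids over $\pi$: a sheaf of $\mathcal O_X$-modules (for example, but not necessarily, reflexive and flat over $S$) with an $\mathcal O_X$-linear anchor $a_S:A_S\to T_{X|S}=\ker p$ and a $\pi^{-1}\mathcal O_S$-bilinear skew-symmetric bracket satisfying the Jacobi identity and $\{f\alpha,\beta\}=f\{\alpha,\beta\}-a_S(\beta)(f)\,\alpha$. Assume that $A_S$ is faithful: a section of $\mathcal O_X$ over an open set $V$ that annihilates $A_S|_V$ is zero. A $\mathbb C$-linear endomorphism $\psi$ of $A_S|_V$ is a differential operator of order $\le 1$ if for every local section $f$ of $\mathcal O_X$ its commutator with multiplication by $f$ is multiplication by a local section of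 $\mathcal O_X$; by faithfulness this section is unique, and it is denoted $\sigma(\psi)(f)$, where $\sigma(\psi)\in T_X(V)$ is the symbol of $\psi$. Let $U(A_S)$ be the sheaf of those differential operators $\psi$ of order $\le1$ on $A_S$ that are derivations of the bracket and satisfy $p(\sigma(\psi))\in\pi^{-1}T_S$, and let $\mathfrak u(A_S)$ be the quotient sheaf of $U(A_S)$ by the image of $A_S$ under $\alpha\mapsto\{\alpha,-\}$. Then: 1. The natural map $T_S\to\pi_*\pi^{-1}T_S$ is an isomorphism. 2. The commutator $[\psi,\varphi]=\psi\varphi-\varphi\psi$ induces a bracket on $\mathfrak u(A_S)$ making it a sheaf of Lie algebras, and the symbol induces a morphism of sheaves $a_{\mathfrak u}:\mathfrak u(A_S)\to\pi^{-1}T_S$, $[\psi]\mapsto p(\sigma(\psi))$. 3. $\pi_*\mathfrak u(A_S)$ is a Lie algebroid over $S$: it is a sheaf of $\mathcal O_S$-modules, where a function $g$ on an open set of $S$ acts by $\psi\mapsto(g\circ\pi)\psi$; its bracket is the push-forward of the bracket of $\mathfrak u(A_S)$, is $\mathbb C$-bilinear and skew-symmetric and satisfies the Jacobi identity; its anchor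 is the $\mathcal O_S$-linear morphism $\rho:\pi_*\mathfrak u(A_S)\xrightarrow{\pi_*a_{\mathfrak u}}\pi_*\pi^{-1}T_S\cong T_S$; and $[g s,t]=g[s,t]-\rho(t)(g)\,s$ for local sections $g$ of $\mathcal O_S$ and $s,t$ of $\pi_*\mathfrak u(A_S)$. (Coherence or reflexivity of $\pi_*\mathfrak u(A_S)$ is not asserted.) -/

import Mathlib

open CategoryTheory TopologicalSpace Opposite AlgebraicGeometry

universe u

noncomputable section

namespace LieAlgd

/-! ### Ringed spaces over `ℂ` -/

/-- A topological space with a sheaf of commutative `ℂ`-algebras. -/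
abbrev CSpace := SheafedSpace.{u + 1, u, u} (CommAlgCat.{u} ℂ)

/-- Sections of the structure sheaf. -/
abbrev O (X : CSpace.{u}) (V : Opens X) : Type u := X.presheaf.obj (op V)

/-- Restriction of sections of the structure sheaf. -/
def res {X : CSpace.{u}} {V W : Opens X} (h : V ≤ W) : O X W →ₐ[ℂ] O X V :=
  (X.presheaf.map (homOfLE h).op).hom

theorem res_res {X : CSpace.{u}} {V W Z : Opens X} (h : V ≤ W) (k : W ≤ Z) (f : O X Z) :
    res h (res k f) = res (h.trans k) f := by
  have : X.presheaf.map (homOfLE (h.trans k)).op =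
      X.presheaf.map (homOfLE k).op ≫ X.presheaf.map (homOfLE h).op := by
    rw [← Functor.map_comp]; rfl
  simp only [res, this]; rfl

theorem res_self {X : CSpace.{u}} {V : Opens X} (h : V ≤ V) (f : O X V) : res h f = f := by
  have : X.presheaf.map (homOfLE h).op = 𝟙 _ := X.presheaf.map_id _
  simp only [res, this]; rfl

/-- The preimage of an open set. -/
abbrev pre {X S : CSpace.{u}} (π : X ⟶ S) (W : Opens S) : Opens X :=
  (Opens.map π.hom.base).obj W

theorem pre_mono {X S : CSpace.{u}} (π : X ⟶ S) {W W' : Opens S} (h : W' ≤ W) :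
    pre π W' ≤ pre π W := fun _ hx => h hx

/-- The comorphism `𝒪_S(W) → 𝒪_X(π⁻¹W)`. -/
def pull {X S : CSpace.{u}} (π : X ⟶ S) (W : Opens S) : O S W →ₐ[ℂ] O X (pre π W) :=
  (π.hom.c.app (op W)).hom

theorem pull_res {X S : CSpace.{u}} (π : X ⟶ S) {W W' : Opens S} (h : W' ≤ W) (g : O S W) :
    pull π W' (res h g) = res (pre_mono π h) (pull π W g) := by
  have := π.hom.c.naturality (homOfLE h).op
  exact congrArg (fun φ => CommAlgCat.Hom.hom φ g) this

/-! ### Complex analytic spaces -/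

/-- The algebra of holomorphic functions on an open subset of a normed space. -/
def holo {E : Type*} [NormedAddCommGroup E] [NormedSpace ℂ E] (W : Opens E) :
    Subalgebra ℂ (W → ℂ) where
  carrier := {f | ∃ F : E → ℂ, DifferentiableOn ℂ F W ∧ ∀ z : W, f z = F z}
  mul_mem' := by
    rintro f g ⟨F, hF, hf⟩ ⟨G, hG, hg⟩
    exact ⟨F * G, hF.mul hG, fun z => by simp [hf, hg]⟩
  add_mem' := by
    rintro f g ⟨F, hF, hf⟩ ⟨G, hG, hg⟩
    exact ⟨F + G, hF.add hG, fun z => by simp [hf, hg]⟩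
  algebraMap_mem' c := ⟨fun _ => c, differentiableOn_const c, fun _ => rfl⟩

/-- Restriction of holomorphic functions. -/
def holoRes {E : Type*} [NormedAddCommGroup E] [NormedSpace ℂ E] {V W : Opens E} (h : V ≤ W)
    (F : holo W) : holo V :=
  ⟨fun z => F.1 ⟨z, h z.2⟩, by
    obtain ⟨G, hG, hF⟩ := F.2
    exact ⟨G, hG.mono h, fun z => hF _⟩⟩

/-- The cylinder `W × E'`. -/
def cyl {E : Type*} (E' : Type*) [TopologicalSpace E] [TopologicalSpace E'] (W : Opens E) :
    Opens (E × E') :=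
  ⟨Prod.fst ⁻¹' (W : Set E), W.2.preimage continuous_fst⟩

/-- The holomorphic function `(z, t) ↦ F z` on `W × E'`. -/
def holoFst {E : Type*} (E' : Type*) [NormedAddCommGroup E] [NormedSpace ℂ E]
    [NormedAddCommGroup E'] [NormedSpace ℂ E'] {W : Opens E} (F : holo W) : holo (cyl E' W) :=
  ⟨fun z => F.1 ⟨z.1.1, z.2⟩, by
    obtain ⟨G, hG, hF⟩ := F.2
    exact ⟨G ∘ Prod.fst, hG.comp differentiableOn_fst fun _ hz => hz, fun z => hF _⟩⟩

/-- A morphism of `ℂ`-ringed spaces from an open subspace `source` of `X` to the space `E` with its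
sheaf of holomorphic functions. The values of `toFun` outside `source` play no role. -/
structure MapToModel (X : CSpace.{u}) (E : Type) [NormedAddCommGroup E] [NormedSpace ℂ E] where
  source : Opens X
  toFun : X → E
  continuousOn : ContinuousOn toFun source
  /-- The comorphism on sections over `W`, with values in `𝒪_X(source ∩ toFun⁻¹ W)`. -/
  comap : ∀ W : Opens E,
    holo W →ₐ[ℂ] O X (⟨source ∩ toFun ⁻¹' W, continuousOn.isOpen_inter_preimage source.2 W.2⟩ : Opens X)
  comap_res : ∀ {V W : Opens E} (h : V ≤ W) (F : holo W),
    comap V (holoRes h F) = res (Set.inter_subset_inter_right _ (Set.preimage_mono h)) (comap W F)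

/-- The open set `source ∩ toFun⁻¹ W`. -/
abbrev MapToModel.pre {X : CSpace.{u}} {E : Type} [NormedAddCommGroup E] [NormedSpace ℂ E]
    (c : MapToModel X E) (W : Opens E) : Opens X :=
  ⟨c.source ∩ c.toFun ⁻¹' W, c.continuousOn.isOpen_inter_preimage c.source.2 W.2⟩

/-- An isomorphism of `ℂ`-ringed spaces from an open subspace of `X` onto the local model defined
by finitely many holomorphic functions `eqn` on an open set `domain` of `E`, i.e. onto the common
zero set `Z` of these functions, with the restriction to `Z` of `𝒪_domain / (eqn)` as structure
sheaf. It is encoded by a morphism to `E` which is a homeomorphism onto `Z` and is on each stalk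
surjective with kernel generated by the germs of the functions `eqn`. -/
structure AnalyticChart (X : CSpace.{u}) (E : Type) [NormedAddCommGroup E] [NormedSpace ℂ E]
    (k : ℕ) extends MapToModel X E where
  domain : Opens E
  eqn : Fin k → holo domain
  isEmbedding : Topology.IsEmbedding (fun x : source => toFun x)
  image_eq : toFun '' source = {z | ∃ h : z ∈ domain, ∀ i, (eqn i).1 ⟨z, h⟩ = 0}
  stalk_surjective : ∀ x ∈ source, ∀ V : Opens X, x ∈ V → ∀ s : O X V,
    ∃ (W : Opens E) (F : holo W) (V' : Opens X) (h : V' ≤ V) (h' : V' ≤ toMapToModel.pre W),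
      x ∈ V' ∧ res h s = res h' (comap W F)
  stalk_ker : ∀ x ∈ source, ∀ W : Opens E, toFun x ∈ W → ∀ F : holo W,
    (∃ (V' : Opens X) (h' : V' ≤ toMapToModel.pre W), x ∈ V' ∧ res h' (comap W F) = 0) ↔
    ∃ (W' : Opens E) (h : W' ≤ W) (hd : W' ≤ domain) (a : Fin k → holo W'),
      toFun x ∈ W' ∧ holoRes h F = ∑ i, a i * holoRes hd (eqn i)

/-- A (Hausdorff) complex analytic space: a `ℂ`-ringed space which is locally isomorphic to local
models. Complex manifolds are the case where the charts can be chosen without equations. -/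
structure IsAnalyticSpace (X : CSpace.{u}) : Prop where
  t2 : T2Space X
  exists_chart : ∀ x : X, ∃ (n k : ℕ) (c : AnalyticChart X (Fin n → ℂ) k), x ∈ c.source

/-- A smooth morphism (submersion): locally on `X`, it is isomorphic to a projection `Z × B → Z`
with `Z` a local model of `S` and `B` an open set of some `ℂ^d`. -/
def IsSmoothMorphism {X S : CSpace.{u}} (π : X ⟶ S) : Prop :=
  ∀ x : X, ∃ (n k d : ℕ) (c : AnalyticChart S (Fin n → ℂ) k)
    (e : AnalyticChart X ((Fin n → ℂ) × (Fin d → ℂ)) k) (B : Opens (Fin d → ℂ)),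
    x ∈ e.source ∧
    (∀ y ∈ e.source, π.hom.base y ∈ c.source ∧ (e.toFun y).1 = c.toFun (π.hom.base y)) ∧
    (∀ z, z ∈ e.domain ↔ z.1 ∈ c.domain ∧ z.2 ∈ B) ∧
    (∀ i z (hz : z ∈ e.domain) (hz' : z.1 ∈ c.domain),
      (e.eqn i).1 ⟨z, hz⟩ = (c.eqn i).1 ⟨z.1, hz'⟩) ∧
    ∀ (W : Opens (Fin n → ℂ)) (F : holo W) (V : Opens X)
      (h : V ≤ e.pre (cyl (Fin d → ℂ) W)) (h' : V ≤ pre π (c.pre W)),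
      res h (e.comap _ (holoFst (Fin d → ℂ) F)) = res h' (pull π _ (c.comap W F))

/-! ### Vector fields -/

theorem leOf {X : CSpace.{u}} {V : Opens X} (V' : Set.Iic V) : V'.1 ≤ V := V'.2


/-- Sections over `V` of the tangent sheaf `T_X`: derivations of the sheaf `𝒪_X|_V`. -/
def VF (X : CSpace.{u}) (V : Opens X) :
    AddSubgroup (∀ V' : Set.Iic V, Derivation ℂ (O X V'.1) (O X V'.1)) where
  carrier := {D | ∀ (V' V'' : Set.Iic V) (h : V''.1 ≤ V'.1) (f : O X V'.1),
    D V'' (res h f) = res h (D V' f)}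
  add_mem' := by
    intro D E hD hE V' V'' h f
    simp [hD _ _ h, hE _ _ h]
  zero_mem' := by intro V' V'' h f; simp
  neg_mem' := by
    intro D hD V' V'' h f
    simp [hD _ _ h]

/-- The commutator of vector fields. -/
def VF.lie {X : CSpace.{u}} {V : Opens X} (D E : VF X V) : VF X V :=
  ⟨fun V' => ⁅D.1 V', E.1 V'⁆, fun V' V'' h f => by
    simp [Derivation.commutator_apply, D.2 V' V'' h, E.2 V' V'' h]⟩

/-- Restriction of vector fields. -/
def VF.res {X : CSpace.{u}} {V W : Opens X} (h : V ≤ W) (D : VF X W) : VF X V :=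
  ⟨fun V' => D.1 ⟨V'.1, V'.2.trans h⟩, fun V' V'' k f =>
    D.2 ⟨V'.1, V'.2.trans h⟩ ⟨V''.1, V''.2.trans h⟩ k f⟩

/-- The product of a function and a vector field. -/
def VF.smul {X : CSpace.{u}} {V : Opens X} (f : O X V) (D : VF X V) : VF X V :=
  ⟨fun V' => LieAlgd.res (leOf V') f • D.1 V', fun V' V'' k g => by
    simp only [Derivation.coe_smul, Pi.smul_apply, smul_eq_mul, map_mul, D.2 V' V'' k, res_res]⟩

/-- Sections over `V` of `π^* T_S`, viewed as derivations from `π⁻¹𝒪_S` to `𝒪_X`. -/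
@[ext] structure DerAlong {X S : CSpace.{u}} (π : X ⟶ S) (V : Opens X) where
  toFun : ∀ W : Opens S, O S W →ₗ[ℂ] O X (V ⊓ pre π W)
  leibniz : ∀ (W : Opens S) (g g' : O S W), toFun W (g * g') =
    res inf_le_right (pull π W g) * toFun W g' + res inf_le_right (pull π W g') * toFun W g
  naturality : ∀ {W W' : Opens S} (h : W' ≤ W) (g : O S W),
    toFun W' (LieAlgd.res h g) = LieAlgd.res (inf_le_inf_left V (pre_mono π h)) (toFun W g)

variable {X S : CSpace.{u}} {π : X ⟶ S}

/-- Restriction of sections of `π^* T_S`. -/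
def DerAlong.res {V V' : Opens X} (h : V' ≤ V) (δ : DerAlong π V) : DerAlong π V' where
  toFun W := (LieAlgd.res (inf_le_inf_right (pre π W) h)).toLinearMap ∘ₗ δ.toFun W
  leibniz W g g' := by simp [δ.leibniz, res_res]
  naturality h g := by simp [δ.naturality h, res_res]

/-- The section `δ` of `π^* T_S` is on `V'` the pullback of the vector field `Y` on `W`. -/
def DerAlong.AgreesOn {V : Opens X} (δ : DerAlong π V) {W : Opens S} (Y : VF S W)
    (V' : Opens X) : Prop :=
  ∀ (W' : Opens S) (h : W' ≤ W) (g : O S W'),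
    LieAlgd.res (inf_le_right : V' ⊓ (V ⊓ pre π W') ≤ V ⊓ pre π W') (δ.toFun W' g) =
    LieAlgd.res (inf_le_right.trans inf_le_right : V' ⊓ (V ⊓ pre π W') ≤ pre π W')
      (pull π W' (Y.1 ⟨W', h⟩ g))

/-- The section `δ` of `π^* T_S` lies in `π⁻¹ T_S`: locally, it is the pullback of a
vector field on `S`. -/
def DerAlong.IsBasic {V : Opens X} (δ : DerAlong π V) : Prop :=
  ∀ x ∈ V, ∃ (W : Opens S) (Y : VF S W) (V' : Opens X),
    π.hom.base x ∈ W ∧ x ∈ V' ∧ δ.AgreesOn Y V'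

/-- Agreement with a vector field in terms of sections over smaller open sets. -/
theorem DerAlong.agreesOn_iff {V : Opens X} (δ : DerAlong π V) {W : Opens S} (Y : VF S W)
    (V' : Opens X) : δ.AgreesOn Y V' ↔
    ∀ (W' : Opens S) (h : W' ≤ W) (g : O S W') (N : Opens X) (_ : N ≤ V')
      (hN : N ≤ V ⊓ pre π W'), LieAlgd.res hN (δ.toFun W' g) =
        LieAlgd.res (hN.trans inf_le_right) (pull π W' (Y.1 ⟨W', h⟩ g)) := by
  constructor
  · intro H W' h g N h₁ h₂
    have := congrArg (LieAlgd.res (le_inf h₁ h₂)) (H W' h g)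
    simpa [res_res] using this
  · intro H W' h g
    exact H W' h g _ inf_le_left _

theorem DerAlong.AgreesOn.mono {V : Opens X} {δ : DerAlong π V} {W : Opens S} {Y : VF S W}
    {V' : Opens X} (H : δ.AgreesOn Y V') {W₁ : Opens S} (hW : W₁ ≤ W) {V₁ : Opens X}
    (hV : V₁ ≤ V') : δ.AgreesOn (VF.res hW Y) V₁ := by
  rw [agreesOn_iff] at H ⊢
  intro W' h g N h₁ h₂
  exact H W' (h.trans hW) g N (h₁.trans hV) h₂

/-- Sections over `V` of `π⁻¹ T_S`, as a subsheaf of `π^* T_S`. -/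
def BasicVF (π : X ⟶ S) (V : Opens X) : Type u := {δ : DerAlong π V // δ.IsBasic}

/-- Restriction of sections of `π⁻¹ T_S`. -/
def BasicVF.res {V V' : Opens X} (h : V' ≤ V) (δ : BasicVF π V) : BasicVF π V' :=
  ⟨δ.1.res h, fun x hx => by
    obtain ⟨W, Y, N, hW, hN, H⟩ := δ.2 x (h hx)
    refine ⟨W, Y, N, hW, hN, ?_⟩
    rw [DerAlong.agreesOn_iff] at H ⊢
    intro W' k g M h₁ h₂
    have := H W' k g M h₁ (h₂.trans (inf_le_inf_right _ h))
    simpa [DerAlong.res, res_res] using this⟩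

/-- The projection `T_X → π^* T_S`, `D ↦ D ∘ π^#`; its kernel is the relative tangent sheaf. -/
def projVF (π : X ⟶ S) {V : Opens X} (D : VF X V) : DerAlong π V where
  toFun W := (D.1 ⟨V ⊓ pre π W, Set.mem_Iic.2 inf_le_left⟩).toLinearMap ∘ₗ
    (LieAlgd.res (inf_le_right : V ⊓ pre π W ≤ pre π W)).toLinearMap ∘ₗ (pull π W).toLinearMap
  leibniz W g g' := by simp
  naturality {W W'} h g := by
    have := D.2 ⟨V ⊓ pre π W, Set.mem_Iic.2 inf_le_left⟩
      ⟨V ⊓ pre π W', Set.mem_Iic.2 inf_le_left⟩ (inf_le_inf_left V (pre_mono π h))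
      (LieAlgd.res inf_le_right (pull π W g))
    simp only [res_res] at this
    simp [pull_res, res_res, this]

theorem projVF_agreesOn_iff {V : Opens X} (D : VF X V) {W : Opens S} (Y : VF S W)
    (V' : Opens X) : (projVF π D).AgreesOn Y V' ↔
    ∀ (W' : Opens S) (h : W' ≤ W) (g : O S W') (N : Opens X) (_ : N ≤ V') (hV : N ≤ V)
      (hN : N ≤ pre π W'), D.1 ⟨N, hV⟩ (res hN (pull π W' g)) =
        res hN (pull π W' (Y.1 ⟨W', h⟩ g)) := by
  rw [DerAlong.agreesOn_iff]
  have key : ∀ (W' : Opens S) (g : O S W') (N : Opens X) (hV : N ≤ V) (hN : N ≤ pre π W'),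
      res (le_inf hV hN) ((projVF π D).toFun W' g) = D.1 ⟨N, hV⟩ (res hN (pull π W' g)) := by
    intro W' g N hV hN
    have := D.2 ⟨V ⊓ pre π W', Set.mem_Iic.2 inf_le_left⟩ ⟨N, hV⟩ (le_inf hV hN)
      (res inf_le_right (pull π W' g))
    rw [res_res] at this
    exact this.symm
  constructor
  · intro H W' h g N h₁ hV hN
    rw [← key]
    exact H W' h g N h₁ (le_inf hV hN)
  · intro H W' h g N h₁ h₂
    rw [← H W' h g N h₁ (h₂.trans inf_le_left) (h₂.trans inf_le_right), ← key]

/-- The natural map `T_S(W) → (π_* π⁻¹ T_S)(W)`, `Y ↦ π^# ∘ Y`. -/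
def pullVF (π : X ⟶ S) (W : Opens S) (Y : VF S W) : BasicVF π (pre π W) :=
  ⟨{ toFun := fun W' =>
        (LieAlgd.res (show pre π W ⊓ pre π W' ≤ pre π (W ⊓ W') from le_rfl)).toLinearMap ∘ₗ
          (pull π (W ⊓ W')).toLinearMap ∘ₗ
          (Y.1 ⟨W ⊓ W', Set.mem_Iic.2 inf_le_left⟩).toLinearMap ∘ₗ
          (LieAlgd.res (inf_le_right : W ⊓ W' ≤ W')).toLinearMap
     leibniz := fun W' g g' => by simp [pull_res, res_res]
     naturality := fun {W₁ W₂} h g => by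
        have := Y.2 ⟨W ⊓ W₁, Set.mem_Iic.2 inf_le_left⟩ ⟨W ⊓ W₂, Set.mem_Iic.2 inf_le_left⟩
          (inf_le_inf_left W h) (LieAlgd.res inf_le_right g)
        simp only [res_res] at this
        simp [pull_res, res_res, this] },
   fun x hx => ⟨W, Y, pre π W, hx, hx, by
    intro W' h g
    have := Y.2 ⟨W', h⟩ ⟨W ⊓ W', Set.mem_Iic.2 inf_le_left⟩ inf_le_right g
    simp [pull_res, res_res, this]⟩⟩

/-! ### Sheaves of modules and Lie algebroids -/

/-- Sections of a sheaf of abelian groups. -/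
abbrev Sec {X : CSpace.{u}} (P : TopCat.Sheaf AddCommGrpCat.{u} X.carrier) (V : Opens X) : Type u :=
  P.presheaf.obj (op V)

/-- Restriction of sections. -/
def Sec.res {P : TopCat.Sheaf AddCommGrpCat.{u} X.carrier} {V W : Opens X} (h : V ≤ W) :
    Sec P W →+ Sec P V :=
  (P.presheaf.map (homOfLE h).op).hom

/-- The structure of a sheaf of `𝒪_X`-modules on a sheaf of abelian groups. -/
class OModule (X : CSpace.{u}) (P : TopCat.Sheaf AddCommGrpCat.{u} X.carrier) where
  module : ∀ V : Opens X, Module (O X V) (Sec P V)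
  res_smul : ∀ {V W : Opens X} (h : V ≤ W) (f : O X W) (s : Sec P W),
    Sec.res h (f • s) = res h f • Sec.res h s

attribute [reducible, instance] OModule.module

/-- A bracket making a sheaf of abelian groups a sheaf of Lie rings. -/
structure LieBracketOn (P : TopCat.Sheaf AddCommGrpCat.{u} X.carrier) where
  bracket : ∀ V : Opens X, Sec P V →+ Sec P V →+ Sec P V
  res_bracket : ∀ {V W : Opens X} (h : V ≤ W) (s t : Sec P W),
    Sec.res h (bracket W s t) = bracket V (Sec.res h s) (Sec.res h t)
  skew : ∀ (V : Opens X) (s t : Sec P V), bracket V s t = -bracket V t s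
  jacobi : ∀ (V : Opens X) (r s t : Sec P V), bracket V r (bracket V s t) +
    bracket V s (bracket V t r) + bracket V t (bracket V r s) = 0

/-- A bracket and an anchor making a sheaf of `𝒪_S`-modules a Lie algebroid over `S`. -/
structure LieAlgebroidOn (S : CSpace.{u}) (P : TopCat.Sheaf AddCommGrpCat.{u} S.carrier)
    [OModule S P] extends LieBracketOn P where
  /-- The bracket is `ℂ`-bilinear. -/
  bracket_smul : ∀ (W : Opens S) (c : ℂ) (s t : Sec P W),
    bracket W (algebraMap ℂ (O S W) c • s) t = algebraMap ℂ (O S W) c • bracket W s t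
  /-- The anchor, a morphism of sheaves of `𝒪_S`-modules to `T_S`. -/
  anchor : ∀ W : Opens S, Sec P W →+ VF S W
  res_anchor : ∀ {W W' : Opens S} (h : W' ≤ W) (s : Sec P W),
    anchor W' (Sec.res h s) = VF.res h (anchor W s)
  anchor_smul : ∀ (W : Opens S) (g : O S W) (s : Sec P W),
    anchor W (g • s) = VF.smul g (anchor W s)
  leibniz : ∀ (W : Opens S) (g : O S W) (s t : Sec P W),
    bracket W (g • s) t = g • bracket W s t - ((anchor W t).1 ⟨W, Set.mem_Iic.2 le_rfl⟩ g) • s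

/-- A bracket and an anchor making a sheaf of `𝒪_X`-modules a family of Lie algebroids over
`π : X → S`. The module may be arbitrary: it need be neither reflexive nor flat over `S`. -/
structure LieAlgebroidFamily {X S : CSpace.{u}} (π : X ⟶ S)
    (A : TopCat.Sheaf AddCommGrpCat.{u} X.carrier) [OModule X A] extends LieBracketOn A where
  /-- The bracket is `π⁻¹𝒪_S`-bilinear. -/
  bracket_smul : ∀ (W : Opens S) (V : Opens X) (h : V ≤ pre π W) (g : O S W) (α β : Sec A V),
    bracket V (res h (pull π W g) • α) β = res h (pull π W g) • bracket V α β
  /-- The anchor, a morphism of sheaves of `𝒪_X`-modules to `T_X`. -/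
  anchor : ∀ V : Opens X, Sec A V →+ VF X V
  res_anchor : ∀ {V V' : Opens X} (h : V' ≤ V) (α : Sec A V),
    anchor V' (Sec.res h α) = VF.res h (anchor V α)
  anchor_smul : ∀ (V : Opens X) (f : O X V) (α : Sec A V),
    anchor V (f • α) = VF.smul f (anchor V α)
  /-- The anchor takes values in the relative tangent sheaf, the kernel of `T_X → π^* T_S`. -/
  anchor_relative : ∀ (V : Opens X) (α : Sec A V) (W : Opens S) (g : O S W),
    (projVF π (anchor V α)).toFun W g = 0
  leibniz : ∀ (V : Opens X) (f : O X V) (α β : Sec A V),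
    bracket V (f • α) β = f • bracket V α β - ((anchor V β).1 ⟨V, Set.mem_Iic.2 le_rfl⟩ f) • α

/-- Only the zero function annihilates the restriction of `A` to an open set. -/
def IsFaithful (X : CSpace.{u}) (A : TopCat.Sheaf AddCommGrpCat.{u} X.carrier)
    [OModule X A] : Prop :=
  ∀ (V : Opens X) (f : O X V),
    (∀ (V' : Opens X) (h : V' ≤ V) (α : Sec A V'), res h f • α = 0) → f = 0

/-! ### Differential operators and the sheaf `𝔲(A)` -/

section

variable (A : TopCat.Sheaf AddCommGrpCat.{u} X.carrier) [OModule X A]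

theorem Sec.res_res {A : TopCat.Sheaf AddCommGrpCat.{u} X.carrier} {V W Z : Opens X}
    (h : V ≤ W) (k : W ≤ Z) (α : Sec A Z) :
    Sec.res h (Sec.res k α) = Sec.res (h.trans k) α := by
  have : A.presheaf.map (homOfLE (h.trans k)).op =
      A.presheaf.map (homOfLE k).op ≫ A.presheaf.map (homOfLE h).op := by
    rw [← Functor.map_comp]; rfl
  simp only [Sec.res, this]; rfl

/-- The ring of `ℂ`-linear endomorphisms of the sheaf `A|_V`. -/
def LocalEnd (V : Opens X) : Subring (∀ V' : Set.Iic V, AddMonoid.End (Sec A V'.1)) where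
  carrier := {ψ | (∀ (V' : Set.Iic V) (c : ℂ) (α : Sec A V'.1),
      ψ V' (algebraMap ℂ (O X V'.1) c • α) = algebraMap ℂ (O X V'.1) c • ψ V' α) ∧
    ∀ (V' V'' : Set.Iic V) (h : V''.1 ≤ V'.1) (α : Sec A V'.1),
      ψ V'' (Sec.res h α) = Sec.res h (ψ V' α)}
  mul_mem' := by
    rintro ψ φ ⟨h₁, h₂⟩ ⟨k₁, k₂⟩
    exact ⟨fun V' c α => by simp [h₁, k₁], fun V' V'' h α => by simp [h₂ _ _ h, k₂ _ _ h]⟩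
  one_mem' := ⟨fun _ _ _ => rfl, fun _ _ _ _ => rfl⟩
  add_mem' := by
    rintro ψ φ ⟨h₁, h₂⟩ ⟨k₁, k₂⟩
    refine ⟨fun V' c α => ?_, fun V' V'' h α => ?_⟩
    · change ψ V' _ + φ V' _ = _ • (ψ V' _ + φ V' _)
      rw [h₁, k₁, smul_add]
    · change ψ V'' _ + φ V'' _ = Sec.res h (ψ V' _ + φ V' _)
      rw [h₂ _ _ h, k₂ _ _ h, map_add]
  zero_mem' := ⟨fun V' c α => (smul_zero _).symm, fun _ _ h _ => (map_zero (Sec.res h)).symm⟩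
  neg_mem' := by
    rintro ψ ⟨h₁, h₂⟩
    refine ⟨fun V' c α => ?_, fun V' V'' h α => ?_⟩
    · change -ψ V' _ = _ • -ψ V' _
      rw [h₁, smul_neg]
    · change -ψ V'' _ = Sec.res h (-ψ V' _)
      rw [h₂ _ _ h, map_neg]

variable {A}

/-- Restriction of endomorphisms. -/
def LocalEnd.res {V W : Opens X} (h : V ≤ W) (ψ : LocalEnd A W) : LocalEnd A V :=
  ⟨fun V' => ψ.1 ⟨V'.1, V'.2.trans h⟩, fun V' => ψ.2.1 ⟨V'.1, V'.2.trans h⟩,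
    fun V' V'' => ψ.2.2 ⟨V'.1, V'.2.trans h⟩ ⟨V''.1, V''.2.trans h⟩⟩

/-- The product of a function and an endomorphism. -/
def LocalEnd.smul {V : Opens X} (f : O X V) (ψ : LocalEnd A V) : LocalEnd A V :=
  ⟨fun V' => (DistribSMul.toAddMonoidHom _ (LieAlgd.res (leOf V') f)).comp (ψ.1 V'), fun V' c α => by
      change LieAlgd.res (leOf V') f • ψ.1 V' _ = _ • LieAlgd.res (leOf V') f • ψ.1 V' _
      rw [ψ.2.1, smul_comm],
    fun V' V'' h α => by
      change LieAlgd.res (leOf V'') f • ψ.1 V'' _ = Sec.res h (LieAlgd.res (leOf V') f • ψ.1 V' _)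
      rw [ψ.2.2 _ _ h, OModule.res_smul, res_res]⟩

/-- `ψ` is a differential operator of order `≤ 1`: its commutator with the multiplication by a
local section of `𝒪_X` is the multiplication by a local section of `𝒪_X`. -/
def IsDiffOp {V : Opens X} (ψ : LocalEnd A V) : Prop :=
  ∀ (V' : Set.Iic V) (f : O X V'.1), ∃ g : O X V'.1, ∀ (N : Opens X) (h : N ≤ V'.1) (α : Sec A N),
    ψ.1 ⟨N, h.trans (leOf V')⟩ (res h f • α) - res h f • ψ.1 ⟨N, h.trans (leOf V')⟩ α = res h g • α

/-- The vector field `D` is the symbol of the differential operator `ψ`. -/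
def IsSymbol {V : Opens X} (ψ : LocalEnd A V) (D : VF X V) : Prop :=
  ∀ (V' : Set.Iic V) (f : O X V'.1) (α : Sec A V'.1),
    ψ.1 V' (f • α) - f • ψ.1 V' α = D.1 V' f • α

/-- `ψ` is a derivation of the bracket. -/
def IsLieDer (b : LieBracketOn A) {V : Opens X} (ψ : LocalEnd A V) : Prop :=
  ∀ (V' : Set.Iic V) (α β : Sec A V'.1), ψ.1 V' (b.bracket V'.1 α β) =
    b.bracket V'.1 (ψ.1 V' α) β + b.bracket V'.1 α (ψ.1 V' β)

theorem IsSymbol.isDiffOp {V : Opens X} {ψ : LocalEnd A V} {D : VF X V} (h : IsSymbol ψ D) :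
    IsDiffOp ψ := fun V' f => ⟨D.1 V' f, fun N k α => by
  rw [h ⟨N, k.trans (leOf V')⟩, D.2 V' ⟨N, k.trans (leOf V')⟩ k]⟩

theorem IsSymbol.apply {V : Opens X} {ψ : LocalEnd A V} {D : VF X V} (h : IsSymbol ψ D)
    (V' : Set.Iic V) (f : O X V'.1) (α : Sec A V'.1) :
    ψ.1 V' (f • α) = f • ψ.1 V' α + D.1 V' f • α := by
  rw [← h, add_sub_cancel]

end

namespace LieAlgebroidFamily

variable {A : TopCat.Sheaf AddCommGrpCat.{u} X.carrier} [OModule X A] (F : LieAlgebroidFamily π A)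

/-- Sections over `V` of the sheaf of those derivations of the bracket that are differential
operators of order `≤ 1` whose symbol is mapped into `π⁻¹ T_S` by `T_X → π^* T_S`. -/
def U (V : Opens X) : AddSubgroup (LocalEnd A V) where
  carrier := {ψ | IsLieDer F.toLieBracketOn ψ ∧ IsDiffOp ψ ∧
    ∃ D : VF X V, IsSymbol ψ D ∧ (projVF π D).IsBasic}
  add_mem' := by
    rintro ψ φ ⟨h₁, h₂, D, hD, bD⟩ ⟨k₁, k₂, E, hE, bE⟩
    have hs : IsSymbol (ψ + φ) (D + E) := by
      intro V' f α
      change (ψ.1 _ _ + φ.1 _ _) - _ • (ψ.1 _ _ + φ.1 _ _) = (D.1 V' f + E.1 V' f) • α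
      rw [add_smul, ← hD, ← hE, smul_add]
      abel
    refine ⟨fun V' α β => ?_, hs.isDiffOp, D + E, hs, fun x hx => ?_⟩
    · change ψ.1 V' _ + φ.1 V' _ = F.bracket _ (ψ.1 V' _ + φ.1 V' _) _ +
        F.bracket _ _ (ψ.1 V' _ + φ.1 V' _)
      rw [h₁, k₁, map_add, map_add, AddMonoidHom.add_apply]
      abel
    · obtain ⟨W, Y, N, hW, hN, H⟩ := bD x hx
      obtain ⟨W', Y', N', hW', hN', H'⟩ := bE x hx
      refine ⟨W ⊓ W', VF.res inf_le_left Y + VF.res inf_le_right Y', N ⊓ N', ⟨hW, hW'⟩,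
        ⟨hN, hN'⟩, ?_⟩
      have e₁ := H.mono (inf_le_left : W ⊓ W' ≤ W) (inf_le_left : N ⊓ N' ≤ N)
      have e₂ := H'.mono (inf_le_right : W ⊓ W' ≤ W') (inf_le_right : N ⊓ N' ≤ N')
      intro Z h g
      have := congrArg₂ (· + ·) (e₁ Z h g) (e₂ Z h g)
      simp only [← map_add] at this
      exact this
  zero_mem' := by
    have hs : IsSymbol (0 : LocalEnd A V) 0 := by
      intro V' f α
      change 0 - _ • 0 = (0 : O X V'.1) • α
      simp
    refine ⟨fun V' α β => ?_, hs.isDiffOp, 0, hs, fun x hx => ?_⟩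
    · change 0 = F.bracket _ 0 _ + F.bracket _ _ 0
      simp
    · refine ⟨⊤, 0, ⊤, trivial, trivial, fun Z h g => ?_⟩
      change res _ 0 = res _ (pull π Z 0)
      simp
  neg_mem' := by
    rintro ψ ⟨h₁, h₂, D, hD, bD⟩
    have hs : IsSymbol (-ψ) (-D) := by
      intro V' f α
      change -ψ.1 _ _ - _ • -ψ.1 _ _ = (-D.1 V' f) • α
      rw [neg_smul, ← hD, smul_neg]
      abel
    refine ⟨fun V' α β => ?_, hs.isDiffOp, -D, hs, fun x hx => ?_⟩
    · change -ψ.1 V' _ = F.bracket _ (-ψ.1 V' _) _ + F.bracket _ _ (-ψ.1 V' _)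
      rw [h₁, map_neg, map_neg, AddMonoidHom.neg_apply]
      abel
    · obtain ⟨W, Y, N, hW, hN, H⟩ := bD x hx
      refine ⟨W, -Y, N, hW, hN, ?_⟩
      rw [projVF_agreesOn_iff] at H ⊢
      intro Z h g M l₁ l₂ l₃
      change -D.1 ⟨M, l₂⟩ _ = res l₃ (pull π Z (-Y.1 ⟨Z, h⟩ g))
      rw [H Z h g M l₁ l₂ l₃, map_neg, map_neg]

/-- Restriction of sections of `U`. -/
def Ures {V W : Opens X} (h : V ≤ W) : F.U W →+ F.U V where
  toFun ψ := ⟨LocalEnd.res h ψ.1, by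
    obtain ⟨h₁, h₂, D, hD, bD⟩ := ψ.2
    refine ⟨fun V' => h₁ ⟨V'.1, V'.2.trans h⟩, fun V' => h₂ ⟨V'.1, V'.2.trans h⟩, VF.res h D,
      fun V' => hD ⟨V'.1, V'.2.trans h⟩, fun x hx => ?_⟩
    obtain ⟨Z, Y, N, hZ, hN, H⟩ := bD x (h hx)
    refine ⟨Z, Y, N, hZ, hN, ?_⟩
    rw [projVF_agreesOn_iff] at H ⊢
    exact fun W' k g M h₁ h₂ h₃ => H W' k g M h₁ (h₂.trans h) h₃⟩
  map_zero' := rfl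
  map_add' _ _ := rfl

/-- The commutator `ψ ∘ φ - φ ∘ ψ` of sections of `U`. -/
def Ulie {V : Opens X} (ψ φ : F.U V) : F.U V :=
  ⟨ψ.1 * φ.1 - φ.1 * ψ.1, by
    obtain ⟨ψ, h₁, -, D, hD, bD⟩ := ψ
    obtain ⟨φ, k₁, -, E, hE, bE⟩ := φ
    have hs : IsSymbol (ψ * φ - φ * ψ) (VF.lie D E) := by
      intro V' f α
      change (ψ.1 V' (φ.1 V' _) - φ.1 V' (ψ.1 V' _)) -
        _ • (ψ.1 V' (φ.1 V' _) - φ.1 V' (ψ.1 V' _)) = (⁅D.1 V', E.1 V'⁆ f) • α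
      rw [Derivation.commutator_apply, hD.apply, hE.apply, map_add, map_add, hD.apply, hD.apply,
        hE.apply, hE.apply, sub_smul, smul_sub]
      abel
    refine ⟨fun V' α β => ?_, hs.isDiffOp, _, hs, fun x hx => ?_⟩
    · change ψ.1 V' (φ.1 V' _) - φ.1 V' (ψ.1 V' _) =
        F.bracket _ (ψ.1 V' (φ.1 V' _) - φ.1 V' (ψ.1 V' _)) _ +
        F.bracket _ _ (ψ.1 V' (φ.1 V' _) - φ.1 V' (ψ.1 V' _))
      rw [h₁, k₁, map_add, map_add, h₁, h₁, k₁, k₁, map_sub, map_sub, AddMonoidHom.sub_apply]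
      abel
    · obtain ⟨W, Y, N, hW, hN, H⟩ := bD x hx
      obtain ⟨W', Y', N', hW', hN', H'⟩ := bE x hx
      refine ⟨W ⊓ W', VF.lie (VF.res inf_le_left Y) (VF.res inf_le_right Y'), N ⊓ N', ⟨hW, hW'⟩,
        ⟨hN, hN'⟩, ?_⟩
      have e₁ := H.mono (inf_le_left : W ⊓ W' ≤ W) (inf_le_left : N ⊓ N' ≤ N)
      have e₂ := H'.mono (inf_le_right : W ⊓ W' ≤ W') (inf_le_right : N ⊓ N' ≤ N')
      rw [projVF_agreesOn_iff] at e₁ e₂ ⊢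
      intro Z h g M l₁ l₂ l₃
      change ⁅D.1 ⟨M, l₂⟩, E.1 ⟨M, l₂⟩⁆ _ = res l₃ (pull π Z
        (⁅(VF.res inf_le_left Y).1 ⟨Z, h⟩, (VF.res inf_le_right Y').1 ⟨Z, h⟩⁆ g))
      rw [Derivation.commutator_apply, Derivation.commutator_apply, e₁ Z h g M l₁ l₂ l₃,
        e₂ Z h g M l₁ l₂ l₃, e₁ Z h _ M l₁ l₂ l₃, e₂ Z h _ M l₁ l₂ l₃, map_sub, map_sub]⟩

/-- The product of a function on an open set `W` of `S` and a section of `U` over `V ⊆ π⁻¹W`. -/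
def Usmul {V : Opens X} {W : Opens S} (h : V ≤ pre π W) (g : O S W) (ψ : F.U V) : F.U V :=
  ⟨LocalEnd.smul (res h (pull π W g)) ψ.1, by
    obtain ⟨ψ, h₁, -, D, hD, bD⟩ := ψ
    have hs : IsSymbol (LocalEnd.smul (res h (pull π W g)) ψ)
        (VF.smul (res h (pull π W g)) D) := by
      intro V' f α
      change res (leOf V') (res h (pull π W g)) • ψ.1 V' _ -
        f • res (leOf V') (res h (pull π W g)) • ψ.1 V' _ =
        (res (leOf V') (res h (pull π W g)) * D.1 V' f) • α
      rw [mul_smul, ← hD, smul_sub, smul_comm f]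
    refine ⟨fun V' α β => ?_, hs.isDiffOp, _, hs, fun x hx => ?_⟩
    · change res (leOf V') (res h (pull π W g)) • ψ.1 V' _ =
        F.bracket _ (res (leOf V') (res h (pull π W g)) • ψ.1 V' _) _ +
        F.bracket _ _ (res (leOf V') (res h (pull π W g)) • ψ.1 V' _)
      rw [F.skew _ α (_ • _), res_res, F.bracket_smul, F.bracket_smul, h₁, smul_add,
        F.skew _ α (ψ.1 V' β), smul_neg]
    · obtain ⟨Z, Y, N, hZ, hN, H⟩ := bD x hx
      refine ⟨W ⊓ Z, VF.smul (res inf_le_left g) (VF.res inf_le_right Y), N, ⟨h hx, hZ⟩, hN, ?_⟩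
      have e := H.mono (inf_le_right : W ⊓ Z ≤ Z) (le_refl N)
      rw [projVF_agreesOn_iff] at e ⊢
      intro Z' k f M l₁ l₂ l₃
      change res l₂ (res h (pull π W g)) * D.1 ⟨M, l₂⟩ _ = res l₃ (pull π Z'
        (res k (res inf_le_left g) * (VF.res inf_le_right Y).1 ⟨Z', k⟩ f))
      rw [e Z' k f M l₁ l₂ l₃, map_mul, map_mul, res_res, res_res, pull_res, res_res]⟩

theorem bracket_smul_right (V : Opens X) (f : O X V) (α β : Sec A V) :
    F.bracket V α (f • β) =
      f • F.bracket V α β + ((F.anchor V α).1 ⟨V, Set.mem_Iic.2 le_rfl⟩ f) • β := by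
  rw [F.skew, F.leibniz, F.skew V α β, smul_neg]
  abel

/-- The endomorphism `{α, -}`. -/
def adEnd {V : Opens X} (α : Sec A V) : LocalEnd A V :=
  ⟨fun V' => F.bracket V'.1 (Sec.res (leOf V') α), fun V' c β => by
      change F.bracket V'.1 (Sec.res (leOf V') α) _ = _ • F.bracket V'.1 (Sec.res (leOf V') α) β
      rw [F.bracket_smul_right, Derivation.map_algebraMap, zero_smul, add_zero],
    fun V' V'' h β => by
      change F.bracket V''.1 (Sec.res (leOf V'') α) _ =
        Sec.res h (F.bracket V'.1 (Sec.res (leOf V') α) β)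
      rw [F.res_bracket, Sec.res_res]⟩

/-- The symbol of `{α, -}` is the anchor of `α`. -/
theorem isSymbol_adEnd {V : Opens X} (α : Sec A V) : IsSymbol (F.adEnd α) (F.anchor V α) := by
  intro V' f β
  change F.bracket V'.1 (Sec.res (leOf V') α) (f • β) -
    f • F.bracket V'.1 (Sec.res (leOf V') α) β = _
  rw [F.bracket_smul_right, F.res_anchor, add_sub_cancel_left]
  rfl

/-- The morphism `A → U`, `α ↦ {α, -}`. -/
def ad (V : Opens X) : Sec A V →+ F.U V where
  toFun α := ⟨F.adEnd α, by
    refine ⟨fun V' β γ => ?_, (F.isSymbol_adEnd α).isDiffOp, _, F.isSymbol_adEnd α, fun x hx => ?_⟩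
    · change F.bracket _ (Sec.res (leOf V') α) (F.bracket _ β γ) =
        F.bracket _ (F.bracket _ (Sec.res (leOf V') α) β) γ +
        F.bracket _ β (F.bracket _ (Sec.res (leOf V') α) γ)
      have := F.jacobi V'.1 (Sec.res (leOf V') α) β γ
      rw [F.skew _ γ (Sec.res (leOf V') α), map_neg, F.skew _ γ, ← sub_eq_add_neg,
        ← sub_eq_add_neg, sub_sub, sub_eq_zero] at this
      rw [this, add_comm]
    · refine ⟨⊤, 0, ⊤, trivial, trivial, fun Z h g => ?_⟩
      rw [F.anchor_relative]
      change _ = res _ (pull π Z 0)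
      simp⟩
  map_zero' := by
    refine Subtype.ext (Subtype.ext (funext fun V' => ?_))
    change F.bracket V'.1 (Sec.res (leOf V') 0) = 0
    simp
  map_add' α β := by
    refine Subtype.ext (Subtype.ext (funext fun V' => ?_))
    change F.bracket V'.1 (Sec.res (leOf V') (α + β)) =
      F.bracket V'.1 (Sec.res (leOf V') α) + F.bracket V'.1 (Sec.res (leOf V') β)
    simp

theorem Ures_ad {V W : Opens X} (h : V ≤ W) (α : Sec A W) :
    F.Ures h (F.ad W α) = F.ad V (Sec.res h α) := by
  refine Subtype.ext (Subtype.ext (funext fun V' => ?_))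
  change F.bracket V'.1 (Sec.res _ α) = F.bracket V'.1 (Sec.res _ (Sec.res h α))
  rw [Sec.res_res]

/-- The presheaf quotient of `U` by the image of `A`. -/
def preU : (Opens X)ᵒᵖ ⥤ AddCommGrpCat.{u} where
  obj V := AddCommGrpCat.of (F.U V.unop ⧸ (F.ad V.unop).range)
  map i := AddCommGrpCat.ofHom (QuotientAddGroup.map _ _ (F.Ures i.unop.le) (by
    rintro _ ⟨α, rfl⟩
    exact ⟨_, (F.Ures_ad _ α).symm⟩))
  map_id V := by
    refine AddCommGrpCat.hom_ext (AddMonoidHom.ext fun x => ?_)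
    induction x using QuotientAddGroup.induction_on
    rfl
  map_comp i j := by
    refine AddCommGrpCat.hom_ext (AddMonoidHom.ext fun x => ?_)
    induction x using QuotientAddGroup.induction_on
    rfl

/-- The sheaf `𝔲(A)`, the quotient of the sheaf `U` by the image of `A`. -/
def uSheaf : TopCat.Sheaf AddCommGrpCat.{u} X.carrier :=
  (presheafToSheaf (Opens.grothendieckTopology X) AddCommGrpCat.{u}).obj F.preU

/-- The class in `𝔲(A)` of a section of `U`. -/
def cls {V : Opens X} (ψ : F.U V) : Sec F.uSheaf V :=
  ((toSheafify (Opens.grothendieckTopology X) F.preU).app (op V)).hom (QuotientAddGroup.mk ψ)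

/-- The direct image `π_* 𝔲(A)`; its sections over `W` are the sections of `𝔲(A)` over `π⁻¹W`. -/
def pushU : TopCat.Sheaf AddCommGrpCat.{u} S.carrier :=
  (TopCat.Sheaf.pushforward AddCommGrpCat.{u} π.hom.base).obj F.uSheaf

/-- A section of `π_* 𝔲(A)` over `W`, as a section of `𝔲(A)` over `π⁻¹W`. -/
def ofPush {W : Opens S} (s : Sec F.pushU W) : Sec F.uSheaf (pre π W) := s

end LieAlgebroidFamily

end LieAlgd

end

open LieAlgd

/-! There are two ingredients: descent of functions and vector fields along `π`, and descent of
operations on operators to classes modulo inner ones.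

Descent along `π`. Locally `π` is a projection `Z × B → Z`. If `F(z)` lies in the ideal of the
equations of `Z × B`, which do not involve `t ∈ B`, then freezing `t` shows that `F` lies in the
ideal of `Z`. So the germ of a function on `S` is determined by its pullback near any one point of
the fibre (`IsSmoothMorphism.eq_zero_near_of_pull_eq_zero`). Now let `f` on `π⁻¹W` be locally a
pullback. The loci where `f` comes from two given germs at `s` are open and, on the fibre over `s`,
equal or disjoint. As the fibre is connected, one germ serves all of it, and as `π` is closed, it
serves the preimage of a neighbourhood of `s`. These functions glue (`exists_pull_eq`). A basic
field maps functions on `S` to functions that are locally pullbacks, hence to pullbacks of unique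
functions, and uniqueness makes the result a derivation (`pullVF_surjective`).

Descent to classes. Sections of `𝔲(A)` are locally classes of operators, and two operators with the
same class differ locally by some `{α, -}`. An operation on operators that respects classes
therefore glues (`exists_descend₂`). The commutator does, because `[ψ, {α, -}] = {ψ(α), -}`;
multiplication by `g ∘ π` does, because the bracket is bilinear over `π⁻¹𝒪_S`; and the symbol
applied to functions from `S` does, because the symbol of `{α, -}` is the vertical field `a(α)`,
faithfulness making symbols unique. The Leibniz rule is `[gψ, φ] = g[ψ, φ] - σ(φ)(g)ψ` on
representatives. The first ingredient turns the symbol into an anchor with values in `T_S`, whose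
properties are tested after the injective pullback. -/

noncomputable section

namespace LieAlgd

/-! ### Gluing sections -/

/-- The forgetful functor of commutative `ℂ`-algebras is corepresented by the polynomial ring. -/
def commAlgForgetCorep : (forget (CommAlgCat.{u} ℂ)).CorepresentableBy
    (CommAlgCat.of ℂ (MvPolynomial PUnit.{u + 1} ℂ)) where
  homEquiv {B} :=
    { toFun := fun f => f.hom (MvPolynomial.X PUnit.unit)
      invFun := fun b => CommAlgCat.ofHom (MvPolynomial.aeval fun _ => (b : B))
      left_inv := fun f => by
        refine CommAlgCat.hom_ext (MvPolynomial.algHom_ext fun _ => ?_)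
        exact MvPolynomial.aeval_X _ _
      right_inv := fun b => MvPolynomial.aeval_X (fun _ => (b : B)) _ }
  homEquiv_comp _ _ := rfl

/-- Corepresentable functors preserve limits, so the sheaf condition passes to underlying sets,
where gluing takes place. -/
theorem isSheaf_forget_O (X : CSpace.{u}) :
    TopCat.Presheaf.IsSheaf (X.presheaf ⋙ forget (CommAlgCat.{u} ℂ)) := by
  have : (forget (CommAlgCat.{u} ℂ)).IsCorepresentable := commAlgForgetCorep.isCorepresentable
  exact Presheaf.isSheaf_comp_of_isSheaf _ _ _ X.IsSheaf

section

variable {T : TopCat.{u}} {P : TopCat.Presheaf (Type u) T}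

/-- The local data are given by a property `R` instead of an indexed cover: all sections with `R`
over open subsets of `V` form the gluing family. Compatibility forces uniqueness of such a section
over each open set, so no choices are needed. -/
theorem typeSheaf_glue (hP : P.IsSheaf) {V : Opens T} (R : ∀ V' : Opens T, P.obj (op V') → Prop)
    (hcover : ∀ x ∈ V, ∃ V' : Opens T, V' ≤ V ∧ x ∈ V' ∧ ∃ s, R V' s)
    (hcompat : ∀ (V₁ V₂ : Opens T) (s₁ : P.obj (op V₁)) (s₂ : P.obj (op V₂)), V₁ ≤ V → V₂ ≤ V →
      R V₁ s₁ → R V₂ s₂ → P.map (homOfLE (inf_le_left : V₁ ⊓ V₂ ≤ V₁)).op s₁ =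
        P.map (homOfLE (inf_le_right : V₁ ⊓ V₂ ≤ V₂)).op s₂) :
    ∃ s : P.obj (op V), ∀ (V' : Opens T) (h : V' ≤ V) (s' : P.obj (op V')), R V' s' →
      P.map (homOfLE h).op s = s' := by
  let ι := {p : Σ V' : Opens T, P.obj (op V') // p.1 ≤ V ∧ R p.1 p.2}
  let U : ι → Opens T := fun i => i.1.1
  have hV : V ≤ iSup U := fun x hx => by
    obtain ⟨V', h, hx', s, hs⟩ := hcover x hx
    exact Opens.mem_iSup.2 ⟨⟨⟨V', s⟩, h, hs⟩, hx'⟩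
  obtain ⟨s, hs, -⟩ := TopCat.Sheaf.existsUnique_gluing' ⟨P, hP⟩ U V (fun i => homOfLE i.2.1) hV
    (fun i => i.1.2) (fun i j => hcompat _ _ _ _ i.2.1 j.2.1 i.2.2 j.2.2)
  exact ⟨s, fun V' h s' hs' => hs ⟨⟨V', s'⟩, h, hs'⟩⟩

theorem typeSheaf_ext (hP : P.IsSheaf) {V : Opens T} {s t : P.obj (op V)}
    (h : ∀ x ∈ V, ∃ (V' : Opens T) (h : V' ≤ V), x ∈ V' ∧
      P.map (homOfLE h).op s = P.map (homOfLE h).op t) : s = t := by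
  choose N hN hx hst using h
  refine TopCat.Sheaf.eq_of_locally_eq' ⟨P, hP⟩ (fun x : V => N x.1 x.2) V
    (fun x => homOfLE (hN x.1 x.2)) (fun x hx' => Opens.mem_iSup.2 ⟨⟨x, hx'⟩, hx x hx'⟩) s t
    fun i => hst i.1 i.2

end

variable {X S : CSpace.{u}} {π : X ⟶ S}

theorem O_glue {V : Opens X} (R : ∀ V' : Opens X, O X V' → Prop)
    (hcover : ∀ x ∈ V, ∃ V' : Opens X, V' ≤ V ∧ x ∈ V' ∧ ∃ f, R V' f)
    (hcompat : ∀ (V₁ V₂ : Opens X) (f₁ : O X V₁) (f₂ : O X V₂), V₁ ≤ V → V₂ ≤ V →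
      R V₁ f₁ → R V₂ f₂ → res (inf_le_left : V₁ ⊓ V₂ ≤ V₁) f₁ =
        res (inf_le_right : V₁ ⊓ V₂ ≤ V₂) f₂) :
    ∃ f : O X V, ∀ (V' : Opens X) (h : V' ≤ V) (f' : O X V'), R V' f' → res h f = f' :=
  typeSheaf_glue (isSheaf_forget_O X) R hcover hcompat

theorem O_ext {V : Opens X} {f g : O X V}
    (h : ∀ x ∈ V, ∃ (V' : Opens X) (h : V' ≤ V), x ∈ V' ∧ res h f = res h g) : f = g :=
  typeSheaf_ext (isSheaf_forget_O X) h

section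

variable {P : TopCat.Sheaf AddCommGrpCat.{u} X.carrier}

theorem isSheaf_forget_Sec (P : TopCat.Sheaf AddCommGrpCat.{u} X.carrier) :
    TopCat.Presheaf.IsSheaf (P.presheaf ⋙ forget AddCommGrpCat.{u}) :=
  Presheaf.isSheaf_comp_of_isSheaf _ _ _ P.2

theorem Sec_ext {V : Opens X} {s t : Sec P V}
    (h : ∀ x ∈ V, ∃ (V' : Opens X) (h : V' ≤ V), x ∈ V' ∧ Sec.res h s = Sec.res h t) : s = t :=
  typeSheaf_ext (isSheaf_forget_Sec P) h

end

/-! ### Functions and vector fields that are locally pullbacks -/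

/-- The slice `{z | (z, t) ∈ W}`. -/
def slice {E E' : Type*} [TopologicalSpace E] [TopologicalSpace E'] (t : E')
    (W : Opens (E × E')) : Opens E :=
  ⟨(fun z => (z, t)) ⁻¹' (W : Set (E × E')), W.2.preimage (by fun_prop)⟩

/-- The restriction of a holomorphic function to a slice. -/
def holoSlice {E E' : Type*} [NormedAddCommGroup E] [NormedSpace ℂ E]
    [NormedAddCommGroup E'] [NormedSpace ℂ E'] (t : E') {W : Opens (E × E')} (F : holo W) :
    holo (slice t W) :=
  ⟨fun z => F.1 ⟨(z.1, t), z.2⟩, by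
    obtain ⟨G, hG, hF⟩ := F.2
    exact ⟨fun z => G (z, t), hG.comp (by fun_prop) fun _ hz => hz, fun z => hF _⟩⟩

/-- Slicing argument: a relation `F(z) = ∑ aᵢ(z, t) eqnᵢ(z)` near `(z₀, t₀)` restricts to `t = t₀`
and becomes a relation on the base. -/
theorem IsSmoothMorphism.eq_zero_near_of_pull_eq_zero (hπ : IsSmoothMorphism π) {W : Opens S}
    {V : Opens X} (h : V ≤ pre π W) {g : O S W} (hg : res h (pull π W g) = 0) {x : X}
    (hx : x ∈ V) : ∃ (W' : Opens S) (k : W' ≤ W), π.hom.base x ∈ W' ∧ res k g = 0 := by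
  obtain ⟨n, k, d, c, e, B, hxe, hec, hdom, heqn, hcomap⟩ := hπ x
  obtain ⟨hxc, hxt⟩ := hec x hxe
  obtain ⟨W₁, F, V₁, h₁, h₁', hV₁, hF⟩ := c.stalk_surjective (π.hom.base x) hxc W (h hx) g
  have hxW : (e.toFun x).1 ∈ W₁ := by
    rw [hxt]
    exact (h₁' hV₁).2
  let N : Opens X := V ⊓ pre π V₁ ⊓ e.pre (cyl (Fin d → ℂ) W₁)
  have hN₁ : N ≤ pre π V₁ := inf_le_left.trans inf_le_right
  have hNV : N ≤ V := inf_le_left.trans inf_le_left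
  have hzero : res (inf_le_right : N ≤ e.pre (cyl (Fin d → ℂ) W₁))
      -- On `N` the function `F(z)` represents the pullback of `g`, which vanishes there.
      (e.comap _ (holoFst (Fin d → ℂ) F)) = 0 := by
    have e₁ := hcomap W₁ F N inf_le_right (hN₁.trans (pre_mono π h₁'))
    have e₂ := congrArg (fun f => res hN₁ (pull π V₁ f)) hF
    simp only [pull_res, res_res] at e₂
    have e₃ := congrArg (res hNV) hg
    rw [res_res, map_zero] at e₃
    exact e₁.trans (e₂.symm.trans e₃)
  obtain ⟨W', hW', hd, a, hxW', ha⟩ := (e.stalk_ker x hxe _ hxW (holoFst (Fin d → ℂ) F)).1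
    ⟨N, inf_le_right, ⟨⟨hx, hV₁⟩, hxe, hxW⟩, hzero⟩
  have hd' : slice (e.toFun x).2 W' ≤ c.domain := fun z hz => ((hdom _).1 (hd hz)).1
  have hW₁ : slice (e.toFun x).2 W' ≤ W₁ := fun z hz => hW' hz
  -- The coefficients on the base are the `aᵢ` restricted to the slice through the fibre coordinate
  -- of `x`.
  obtain ⟨V', hV', hxV', hres⟩ := (c.stalk_ker (π.hom.base x) hxc W₁ (h₁' hV₁).2 F).2
    ⟨slice (e.toFun x).2 W', hW₁, hd', fun i => holoSlice _ (a i), by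
      change ((c.toFun (π.hom.base x)), (e.toFun x).2) ∈ W'
      rw [← hxt]
      exact hxW', by
      refine Subtype.ext (funext fun z => ?_)
      have := congrArg (fun φ => φ.1 ⟨(z.1, (e.toFun x).2), z.2⟩) ha
      simp only [AddSubmonoidClass.coe_finsetSum, Finset.sum_apply] at this ⊢
      refine this.trans (Finset.sum_congr rfl fun i _ => ?_)
      -- The equations upstairs are those of the base chart and do not depend on `t`.
      exact congrArg (fun w => (a i).1 ⟨(z.1, (e.toFun x).2), z.2⟩ * w)
        (heqn i (z.1, (e.toFun x).2) (hd z.2) (hd' z.2))⟩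
  refine ⟨V₁ ⊓ V', inf_le_left.trans h₁, ⟨hV₁, hxV'⟩, ?_⟩
  have e₁ := congrArg (res (inf_le_left : V₁ ⊓ V' ≤ V₁)) hF
  have e₂ := congrArg (res (inf_le_right : V₁ ⊓ V' ≤ V')) hres
  rw [res_res, res_res] at e₁
  rw [res_res, map_zero] at e₂
  exact e₁.trans e₂

theorem IsSmoothMorphism.eq_near_of_pull_eq (hπ : IsSmoothMorphism π) {W : Opens S}
    {V : Opens X} (h : V ≤ pre π W) {g g' : O S W}
    (hg : res h (pull π W g) = res h (pull π W g')) {x : X}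
    (hx : x ∈ V) : ∃ (W' : Opens S) (k : W' ≤ W), π.hom.base x ∈ W' ∧ res k g = res k g' := by
  obtain ⟨W', k, hx', e⟩ := hπ.eq_zero_near_of_pull_eq_zero h (g := g - g')
    (by rw [map_sub, map_sub, hg, sub_self]) hx
  exact ⟨W', k, hx', sub_eq_zero.1 (by rw [← map_sub, e])⟩

theorem IsSmoothMorphism.pull_injective (hπ : IsSmoothMorphism π)
    (hsurj : Function.Surjective π.hom.base) (W : Opens S) : Function.Injective (pull π W) := by
  intro g g' hg
  refine O_ext fun s hs => ?_
  obtain ⟨x, rfl⟩ := hsurj s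
  obtain ⟨W', k, hx, e⟩ := hπ.eq_near_of_pull_eq (le_refl (pre π W)) (congrArg _ hg) hs
  exact ⟨W', k, hx, e⟩

/-- The function `f` is on a neighbourhood of `x` the pullback of the function `g`. -/
def IsPullAt (π : X ⟶ S) {V : Opens X} (f : O X V) {W : Opens S} (g : O S W) (x : X) : Prop :=
  ∃ (N : Opens X) (h : N ≤ V) (k : N ≤ pre π W), x ∈ N ∧ res h f = res k (pull π W g)

theorem isOpen_isPullAt {V : Opens X} (f : O X V) {W : Opens S} (g : O S W) :
    IsOpen {x | IsPullAt π f g x} := by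
  refine isOpen_iff_mem_nhds.2 fun x ⟨N, h, k, hx, e⟩ => ?_
  filter_upwards [N.2.mem_nhds hx] with y hy using ⟨N, h, k, hy, e⟩

theorem IsPullAt.res_left {V V' : Opens X} {f : O X V} {W : Opens S} {g : O S W} {x : X}
    (H : IsPullAt π f g x) (h : V' ≤ V) (hx : x ∈ V') : IsPullAt π (res h f) g x := by
  obtain ⟨N, h', k, hxN, e⟩ := H
  refine ⟨N ⊓ V', inf_le_right, inf_le_left.trans k, ⟨hxN, hx⟩, ?_⟩
  have := congrArg (res (inf_le_left : N ⊓ V' ≤ N)) e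
  simpa only [res_res] using this

/-- Pullbacks of the same germ have the same germs at all points of the fibre. -/
theorem IsPullAt.congr (hπ : IsSmoothMorphism π) {V : Opens X} {f : O X V} {W W' : Opens S}
    {g : O S W} {g' : O S W'} {x y : X} (hx : IsPullAt π f g x) (hx' : IsPullAt π f g' x)
    (hxy : π.hom.base x = π.hom.base y) (hy : IsPullAt π f g y) : IsPullAt π f g' y := by
  obtain ⟨N, h, k, hxN, e⟩ := hx
  obtain ⟨N', h', k', hxN', e'⟩ := hx'
  obtain ⟨M, l, m, hyM, e''⟩ := hy
  have l₁ : N ⊓ N' ≤ pre π (W ⊓ W') := fun z hz => ⟨k hz.1, k' hz.2⟩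
  have : res l₁ (pull π (W ⊓ W') (res inf_le_left g)) =
      res l₁ (pull π (W ⊓ W') (res inf_le_right g')) := by
    have e₁ := congrArg (res (inf_le_left : N ⊓ N' ≤ N)) e
    have e₂ := congrArg (res (inf_le_right : N ⊓ N' ≤ N')) e'
    simp only [pull_res, res_res] at e₁ e₂ ⊢
    exact e₁.symm.trans e₂
  -- Equality of the pullbacks near the single point `x` identifies the germs of `g` and `g'` at `π
  -- x`, which is also `π y`.
  obtain ⟨Z, hZ, hxZ, eZ⟩ := hπ.eq_near_of_pull_eq l₁ this (x := x) ⟨hxN, hxN'⟩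
  rw [hxy] at hxZ
  refine ⟨M ⊓ pre π Z, inf_le_left.trans l,
    inf_le_right.trans (pre_mono π (hZ.trans inf_le_right)), ⟨hyM, hxZ⟩, ?_⟩
  have e₁ := congrArg (res (inf_le_left : M ⊓ pre π Z ≤ M)) e''
  have e₂ := congrArg (fun q => res (inf_le_right : M ⊓ pre π Z ≤ pre π Z) (pull π Z q)) eZ
  simp only [pull_res, res_res] at e₁ e₂ ⊢
  exact e₁.trans e₂

/-- Connectedness of the fibre: the locus where `f` comes from `g`, and the union of the loci of the
functions that represent `f` at points where `g` fails, are open, cover the fibre and cannot meet on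
it. -/
theorem IsPullAt.of_fibre (hπ : IsSmoothMorphism π)
    (hconn : ∀ s : S, IsConnected (π.hom.base ⁻¹' {s})) {W : Opens S} {f : O X (pre π W)}
    (hf : ∀ x ∈ pre π W, ∃ (Z : Opens S) (g : O S Z), IsPullAt π f g x) {Z : Opens S} {g : O S Z}
    {x y : X} (hx : IsPullAt π f g x) (hxW : x ∈ pre π W)
    (hxy : π.hom.base x = π.hom.base y) : IsPullAt π f g y := by
  by_contra hy
  let u : Set X := {z | IsPullAt π f g z}
  have hW : ∀ z, π.hom.base z = π.hom.base x → z ∈ pre π W := fun z hz => by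
    change π.hom.base z ∈ W
    rw [hz]
    exact hxW
  have key : ∀ z, π.hom.base z = π.hom.base x → ¬ IsPullAt π f g z →
      ∃ (Z' : Opens S) (g' : O S Z'), IsPullAt π f g' z := fun z hz _ => hf z (hW z hz)
  -- Only those `g'` enter that represent `f` at some point of the fibre where `g` does not.
  let v : Set X := ⋃ (Z' : Opens S) (g' : O S Z') (_ : ∃ z, π.hom.base z = π.hom.base x ∧
    ¬ IsPullAt π f g z ∧ IsPullAt π f g' z), {z | IsPullAt π f g' z}
  have hv : IsOpen v :=
    isOpen_iUnion fun _ => isOpen_iUnion fun _ => isOpen_iUnion fun _ => isOpen_isPullAt _ _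
  obtain ⟨z, hzx, hzu, hzv⟩ := (hconn (π.hom.base x)).isPreconnected u v (isOpen_isPullAt _ _) hv
    (fun z hz => by
      by_cases hzu : IsPullAt π f g z
      · exact Or.inl hzu
      · obtain ⟨Z', g', H⟩ := key z hz hzu
        refine Or.inr ?_
        simp only [v, Set.mem_iUnion]
        exact ⟨Z', g', ⟨z, hz, hzu, H⟩, H⟩)
    ⟨x, rfl, hx⟩ ⟨y, hxy.symm, by
      obtain ⟨Z', g', H⟩ := key y hxy.symm hy
      simp only [v, Set.mem_iUnion]
      exact ⟨Z', g', ⟨y, hxy.symm, hy, H⟩, H⟩⟩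
  simp only [v, Set.mem_iUnion] at hzv
  obtain ⟨Z', g', ⟨w, hw, hwn, hw'⟩, hzv⟩ := hzv
  -- At the meeting point `z` both `g` and `g'` represent `f`, so their germs agree and `g` would
  -- also represent `f` at `w`.
  exact hwn (IsPullAt.congr hπ hzv hzu (hzx.trans hw.symm) hw')

/-- A function on the preimage of `W` which is locally on `X` a pullback is the pullback of a
function on `W`. -/
theorem exists_pull_eq (hπ : IsSmoothMorphism π) (hclosed : IsClosedMap π.hom.base)
    (hconn : ∀ s : S, IsConnected (π.hom.base ⁻¹' {s})) {W : Opens S} (f : O X (pre π W))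
    (hf : ∀ x ∈ pre π W, ∃ (Z : Opens S) (g : O S Z), IsPullAt π f g x) :
    ∃ g : O S W, pull π W g = f := by
  have hsurj : Function.Surjective π.hom.base := fun s => (hconn s).nonempty
  let R : ∀ Z : Opens S, O S Z → Prop := fun Z g => ∀ x ∈ pre π Z, IsPullAt π f g x
  have hcov : ∀ s ∈ W, ∃ Z : Opens S, Z ≤ W ∧ s ∈ Z ∧ ∃ g, R Z g := fun s hs => by
    obtain ⟨x, rfl⟩ := hsurj s
    obtain ⟨Z, g, hx⟩ := hf x hs
    have hopen := isOpen_isPullAt (π := π) f g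
    -- Tube argument: the image of the closed bad locus is closed, and its complement contains `π x`
    -- because the whole fibre is good.
    let N : Opens S := ⟨(π.hom.base '' {y | IsPullAt π f g y}ᶜ)ᶜ,
      (hclosed _ hopen.isClosed_compl).isOpen_compl⟩
    have hN : ∀ y, π.hom.base y ∈ N → IsPullAt π f g y := fun y hy => by
      by_contra h
      exact hy ⟨y, h, rfl⟩
    have hxN : π.hom.base x ∈ N := by
      rintro ⟨y, hy, hyx⟩
      exact hy (IsPullAt.of_fibre hπ hconn hf hx hs hyx.symm)
    have hxZ : π.hom.base x ∈ Z := by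
      obtain ⟨M, -, k, hxM, -⟩ := hx
      exact k hxM
    refine ⟨W ⊓ Z ⊓ N, inf_le_left.trans inf_le_left, ⟨⟨hs, hxZ⟩, hxN⟩,
      res (inf_le_left.trans inf_le_right) g, fun y hy => ?_⟩
    obtain ⟨M, l, k, hyM, e⟩ := hN y hy.2
    refine ⟨M ⊓ pre π (W ⊓ Z ⊓ N), inf_le_left.trans l, inf_le_right, ⟨hyM, hy⟩, ?_⟩
    have := congrArg (res (inf_le_left : M ⊓ pre π (W ⊓ Z ⊓ N) ≤ M)) e
    simpa only [pull_res, res_res] using this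
  obtain ⟨g, hg⟩ := O_glue R hcov
    (fun V₁ V₂ g₁ g₂ h₁ h₂ H₁ H₂ => by
      -- Two local solutions agree on overlaps because both pull back to `f`.
      apply hπ.pull_injective hsurj
      refine O_ext fun x hx => ?_
      obtain ⟨M, l, k, hxM, e⟩ := H₁ x hx.1
      obtain ⟨M', l', k', hxM', e'⟩ := H₂ x hx.2
      refine ⟨M ⊓ M', fun y hy => ⟨k hy.1, k' hy.2⟩, ⟨hxM, hxM'⟩, ?_⟩
      have e₁ := congrArg (res (inf_le_left : M ⊓ M' ≤ M)) e
      have e₂ := congrArg (res (inf_le_right : M ⊓ M' ≤ M')) e'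
      simp only [pull_res, res_res] at e₁ e₂ ⊢
      exact (res_res _ _ _).trans ((e₁.symm.trans e₂).trans (res_res _ _ _).symm))
  refine ⟨g, O_ext fun x hx => ?_⟩
  obtain ⟨V', h, hxV, g', H⟩ := hcov (π.hom.base x) hx
  obtain ⟨M, l, k, hxM, e⟩ := H x hxV
  refine ⟨M, l, hxM, ?_⟩
  rw [e, ← hg V' h g' H, pull_res, res_res]

/-! ### Descent of basic vector fields -/

theorem pullVF_toFun (π : X ⟶ S) {W : Opens S} (Y : VF S W) {W' : Opens S} (h : W' ≤ W)
    (g : O S W') : (pullVF π W Y).1.toFun W' g =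
      res inf_le_right (pull π W' (Y.1 ⟨W', h⟩ g)) := by
  -- `pullVF` evaluates `Y` over `W ⊓ W'`; compatibility of `Y` with restriction moves the value to
  -- `W'` itself.
  have := Y.2 ⟨W', h⟩ ⟨W ⊓ W', Set.mem_Iic.2 inf_le_left⟩ inf_le_right g
  change res _ (pull π (W ⊓ W') (Y.1 ⟨W ⊓ W', _⟩ (res _ g))) = _
  rw [this, pull_res, res_res]

theorem pullVF_injective (hπ : IsSmoothMorphism π) (hsurj : Function.Surjective π.hom.base)
    (W : Opens S) : Function.Injective (pullVF π W) := by
  intro Y Y' e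
  refine Subtype.ext (funext fun W' => Derivation.ext fun g => hπ.pull_injective hsurj _ ?_)
  have := congrArg (fun δ => res (le_inf (pre_mono π W'.2) le_rfl) (δ.1.toFun W'.1 g)) e
  simpa only [pullVF_toFun π _ W'.2, res_res, res_self] using this

/-- Where `δ` is the pullback of a field `Y`, the value `δ(g)` is the pullback of `Y(g)`. -/
theorem DerAlong.IsBasic.isPullAt {V : Opens X} {δ : DerAlong π V} (hδ : δ.IsBasic)
    {W : Opens S} (g : O S W) (x : X) (hx : x ∈ V ⊓ pre π W) :
    ∃ (Z : Opens S) (g' : O S Z), IsPullAt π (δ.toFun W g) g' x := by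
  obtain ⟨Z, Y, N, hxZ, hxN, H⟩ := hδ x hx.1
  rw [DerAlong.agreesOn_iff] at H
  refine ⟨Z ⊓ W, Y.1 ⟨Z ⊓ W, Set.mem_Iic.2 inf_le_left⟩ (LieAlgd.res inf_le_right g),
    N ⊓ (V ⊓ pre π (Z ⊓ W)), inf_le_right.trans (inf_le_inf_left V (pre_mono π inf_le_right)),
    inf_le_right.trans inf_le_right, ⟨hxN, hx.1, hxZ, hx.2⟩, ?_⟩
  have := H (Z ⊓ W) inf_le_left (LieAlgd.res inf_le_right g) _
    (inf_le_left : N ⊓ (V ⊓ pre π (Z ⊓ W)) ≤ N) inf_le_right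
  rw [δ.naturality, LieAlgd.res_res] at this
  exact this

/-- Each `δ(g)` descends to a function `Y(g)` by `exists_pull_eq`. Linearity, the Leibniz rule and
compatibility with restriction for `Y` follow from those for `δ`, because pullback of functions is
injective. -/
theorem pullVF_surjective (hπ : IsSmoothMorphism π) (hclosed : IsClosedMap π.hom.base)
    (hconn : ∀ s : S, IsConnected (π.hom.base ⁻¹' {s})) (W : Opens S) :
    Function.Surjective (pullVF π W) := by
  intro δ
  have hinj := hπ.pull_injective fun s => (hconn s).nonempty
  have key : ∀ (W' : Set.Iic W) (g : O S W'.1), ∃ g' : O S W'.1, pull π W'.1 g' =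
      res (le_inf (pre_mono π W'.2) le_rfl) (δ.1.toFun W'.1 g) := fun W' g => by
    refine exists_pull_eq hπ hclosed hconn _ fun x hx => ?_
    obtain ⟨Z, g', H⟩ := δ.2.isPullAt g x ⟨W'.2 hx, hx⟩
    exact ⟨Z, g', H.res_left _ hx⟩
  choose Y hY using key
  refine ⟨⟨fun W' => Derivation.mk'
    { toFun := Y W'
      map_add' := fun g g' => hinj _ (by simp only [map_add, hY])
      map_smul' := fun c g => hinj _ (by simp only [map_smul, hY, RingHom.id_apply]) }
    fun g g' => hinj _ ?_, fun W' W'' h g => hinj _ ?_⟩, ?_⟩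
  · change pull π W'.1 (Y W' (g * g')) = pull π W'.1 (g * Y W' g' + g' * Y W' g)
    simp only [map_add, map_mul, hY, δ.1.leibniz, res_res, res_self]
  · change pull π W''.1 (Y W'' (res h g)) = pull π W''.1 (res h (Y W' g))
    rw [hY, pull_res, hY, δ.1.naturality h, res_res, res_res]
  · refine Subtype.ext (DerAlong.ext (funext fun W' => LinearMap.ext fun g => ?_))
    refine (congrArg (res _) (hY ⟨W ⊓ W', Set.mem_Iic.2 inf_le_left⟩ (res _ g))).trans ?_
    rw [δ.1.naturality, res_res, res_res]
    exact res_self _ _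

/-! ### Uniqueness of symbols -/

theorem Sec.res_self {P : TopCat.Sheaf AddCommGrpCat.{u} X.carrier} {V : Opens X} (h : V ≤ V)
    (s : Sec P V) : Sec.res h s = s := by
  have : P.presheaf.map (homOfLE h).op = 𝟙 _ := P.presheaf.map_id _
  simp only [Sec.res, this]; rfl

/-- The difference of the values of two symbols on `f` annihilates every local section of `A`, so
faithfulness makes it zero. -/
theorem isSymbol_unique {A : TopCat.Sheaf AddCommGrpCat.{u} X.carrier} [OModule X A]
    (hA : IsFaithful X A) {V : Opens X} {ψ : LocalEnd A V} {D E : VF X V} (hD : IsSymbol ψ D)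
    (hE : IsSymbol ψ E) : D = E := by
  refine Subtype.ext (funext fun V' => Derivation.ext fun f => sub_eq_zero.1 (hA _ _ ?_))
  intro N h α
  have e₁ := hD ⟨N, h.trans (leOf V')⟩ (res h f) α
  have e₂ := hE ⟨N, h.trans (leOf V')⟩ (res h f) α
  rw [D.2 V' ⟨N, h.trans (leOf V')⟩ h] at e₁
  rw [E.2 V' ⟨N, h.trans (leOf V')⟩ h] at e₂
  rw [map_sub, sub_smul, ← e₁, ← e₂, sub_self]

namespace LieAlgebroidFamily

variable {A : TopCat.Sheaf AddCommGrpCat.{u} X.carrier} [OModule X A] (F : LieAlgebroidFamily π A)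

/-! ### Classes of sections of `U` -/

theorem res_cls {V W : Opens X} (h : V ≤ W) (ψ : F.U W) :
    Sec.res h (F.cls ψ) = F.cls (F.Ures h ψ) := by
  have := (toSheafify (Opens.grothendieckTopology X) F.preU).naturality (homOfLE h).op
  exact (congrArg (fun f => f.hom (QuotientAddGroup.mk ψ)) this).symm

theorem cls_add {V : Opens X} (ψ φ : F.U V) : F.cls (ψ + φ) = F.cls ψ + F.cls φ :=
  map_add ((toSheafify (Opens.grothendieckTopology X) F.preU).app (op V)).hom
    (QuotientAddGroup.mk ψ) (QuotientAddGroup.mk φ)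

theorem cls_zero {V : Opens X} : F.cls (0 : F.U V) = 0 :=
  map_zero ((toSheafify (Opens.grothendieckTopology X) F.preU).app (op V)).hom

theorem cls_neg {V : Opens X} (ψ : F.U V) : F.cls (-ψ) = -F.cls ψ :=
  map_neg ((toSheafify (Opens.grothendieckTopology X) F.preU).app (op V)).hom
    (QuotientAddGroup.mk ψ)

theorem cls_sub {V : Opens X} (ψ φ : F.U V) : F.cls (ψ - φ) = F.cls ψ - F.cls φ := by
  rw [sub_eq_add_neg, cls_add, cls_neg, sub_eq_add_neg]

theorem cls_ad {V : Opens X} (α : Sec A V) : F.cls (F.ad V α) = 0 := by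
  have : (QuotientAddGroup.mk (F.ad V α) : F.U V ⧸ (F.ad V).range) = 0 :=
    (QuotientAddGroup.eq_zero_iff _).2 ⟨α, rfl⟩
  exact (congrArg ((toSheafify (Opens.grothendieckTopology X) F.preU).app (op V)).hom this).trans
    (map_zero _)

theorem cls_add_ad {V : Opens X} (ψ : F.U V) (α : Sec A V) :
    F.cls (ψ + F.ad V α) = F.cls ψ :=
  (F.cls_add _ _).trans ((congrArg (F.cls ψ + ·) (F.cls_ad α)).trans (add_zero _))

/-- Sections of `𝔲(A)` are locally classes of sections of `U`. -/
theorem exists_cls {V : Opens X} (s : Sec F.uSheaf V) {x : X} (hx : x ∈ V) :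
    ∃ (N : Opens X) (h : N ≤ V), x ∈ N ∧ ∃ ψ : F.U N, Sec.res h s = F.cls ψ := by
  -- The map from a presheaf to its sheafification is locally surjective.
  obtain ⟨N, i, ⟨t, ht⟩, hxN⟩ := Presheaf.imageSieve_mem (Opens.grothendieckTopology X)
    (toSheafify (Opens.grothendieckTopology X) F.preU) (U := op V) s x hx
  obtain ⟨ψ, rfl⟩ := QuotientAddGroup.mk_surjective t
  exact ⟨N, i.le, hxN, ψ, ht.symm⟩

/-- Restriction of a representative of a section of `𝔲(A)`. -/
theorem res_eq_cls_Ures {V N M : Opens X} {h : N ≤ V} {s : Sec F.uSheaf V} {ψ : F.U N}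
    (e : Sec.res h s = F.cls ψ) (k : M ≤ N) : Sec.res (k.trans h) s = F.cls (F.Ures k ψ) :=
  (Sec.res_res k h s).symm.trans ((congrArg (Sec.res k) e).trans (F.res_cls k ψ))

theorem exists_cls₂ {V : Opens X} (s t : Sec F.uSheaf V) {x : X} (hx : x ∈ V) :
    ∃ (N : Opens X) (h : N ≤ V), x ∈ N ∧ ∃ ψ φ : F.U N, Sec.res h s = F.cls ψ ∧
      Sec.res h t = F.cls φ := by
  obtain ⟨N, h, hxN, ψ, hψ⟩ := F.exists_cls s hx
  obtain ⟨M, k, hxM, φ, hφ⟩ := F.exists_cls (Sec.res h t) hxN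
  exact ⟨M, k.trans h, hxM, F.Ures k ψ, φ, F.res_eq_cls_Ures hψ k,
    (Sec.res_res k h t).symm.trans hφ⟩

theorem exists_cls₃ {V : Opens X} (r s t : Sec F.uSheaf V) {x : X} (hx : x ∈ V) :
    ∃ (N : Opens X) (h : N ≤ V), x ∈ N ∧ ∃ χ ψ φ : F.U N, Sec.res h r = F.cls χ ∧
      Sec.res h s = F.cls ψ ∧ Sec.res h t = F.cls φ := by
  obtain ⟨N, h, hxN, χ, ψ, hχ, hψ⟩ := F.exists_cls₂ r s hx
  obtain ⟨M, k, hxM, φ, hφ⟩ := F.exists_cls (Sec.res h t) hxN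
  exact ⟨M, k.trans h, hxM, F.Ures k χ, F.Ures k ψ, φ, F.res_eq_cls_Ures hχ k,
    F.res_eq_cls_Ures hψ k, (Sec.res_res k h t).symm.trans hφ⟩

theorem _root_.QuotientAddGroup.exists_eq_add_of_mk_range_eq {G H : Type*} [AddCommGroup G]
    [AddGroup H] (f : H →+ G) {a b : G}
    (h : (QuotientAddGroup.mk a : G ⧸ f.range) = QuotientAddGroup.mk b) : ∃ α, b = a + f α := by
  obtain ⟨α, hα⟩ := QuotientAddGroup.eq.1 h
  exact ⟨α, by rw [hα, add_neg_cancel_left]⟩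

/-- Sections of `U` with the same class differ locally by the image of a section of `A`. -/
theorem exists_eq_add_ad {V : Opens X} {ψ φ : F.U V} (e : F.cls ψ = F.cls φ) {x : X}
    (hx : x ∈ V) : ∃ (N : Opens X) (h : N ≤ V), x ∈ N ∧ ∃ α : Sec A N,
      F.Ures h ψ = F.Ures h φ + F.ad N α := by
  -- The map to the sheafification is locally injective. Taking `φ` before `ψ` puts the correction
  -- term on the side of `φ`.
  obtain ⟨N, i, hN, hxN⟩ := Presheaf.equalizerSieve_mem (Opens.grothendieckTopology X)
    (toSheafify (Opens.grothendieckTopology X) F.preU) (X := op V) (QuotientAddGroup.mk φ)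
    (QuotientAddGroup.mk ψ) e.symm x hx
  exact ⟨N, i.le, hxN, QuotientAddGroup.exists_eq_add_of_mk_range_eq (F.ad N) hN⟩

/-- Operations on classes of sections of `U` extend to sections of `𝔲(A)`. -/
theorem exists_descend₂ {P : TopCat.Presheaf (Type u) X.carrier} (hP : P.IsSheaf) {V : Opens X}
    (T : ∀ N : Opens X, N ≤ V → F.U N → F.U N → P.obj (op N))
    (hT : ∀ (N M : Opens X) (h : N ≤ V) (k : M ≤ N) (ψ φ : F.U N),
      P.map (homOfLE k).op (T N h ψ φ) = T M (k.trans h) (F.Ures k ψ) (F.Ures k φ))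
    (hcongr : ∀ (N : Opens X) (h : N ≤ V) (ψ ψ' φ φ' : F.U N), F.cls ψ = F.cls ψ' →
      F.cls φ = F.cls φ' → T N h ψ φ = T N h ψ' φ') (s t : Sec F.uSheaf V) :
    ∃ r : P.obj (op V), ∀ (N : Opens X) (h : N ≤ V) (ψ φ : F.U N), Sec.res h s = F.cls ψ →
      Sec.res h t = F.cls φ → P.map (homOfLE h).op r = T N h ψ φ := by
  -- The glued sections are the values of `T` at all representatives over all open subsets; on
  -- overlaps the restricted representatives have equal classes, so `hcongr` applies.
  obtain ⟨r, hr⟩ := typeSheaf_glue hP (V := V) (fun N p => ∃ (h : N ≤ V) (ψ φ : F.U N),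
      Sec.res h s = F.cls ψ ∧ Sec.res h t = F.cls φ ∧ p = T N h ψ φ)
    (fun x hx => by
      obtain ⟨N, h, hxN, ψ, φ, hψ, hφ⟩ := F.exists_cls₂ s t hx
      exact ⟨N, h, hxN, _, h, ψ, φ, hψ, hφ, rfl⟩)
    (by
      rintro V₁ V₂ _ _ - - ⟨h₁, ψ₁, φ₁, e₁, k₁, rfl⟩ ⟨h₂, ψ₂, φ₂, e₂, k₂, rfl⟩
      rw [hT, hT]
      refine hcongr _ _ _ _ _ _ ?_ ?_
      · exact (F.res_eq_cls_Ures e₁ _).symm.trans (F.res_eq_cls_Ures e₂ _)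
      · exact (F.res_eq_cls_Ures k₁ _).symm.trans (F.res_eq_cls_Ures k₂ _))
  exact ⟨r, fun N h ψ φ hψ hφ => hr N h _ ⟨h, ψ, φ, hψ, hφ, rfl⟩⟩

theorem exists_descend {P : TopCat.Presheaf (Type u) X.carrier} (hP : P.IsSheaf) {V : Opens X}
    (T : ∀ N : Opens X, N ≤ V → F.U N → P.obj (op N))
    (hT : ∀ (N M : Opens X) (h : N ≤ V) (k : M ≤ N) (ψ : F.U N),
      P.map (homOfLE k).op (T N h ψ) = T M (k.trans h) (F.Ures k ψ))
    (hcongr : ∀ (N : Opens X) (h : N ≤ V) (ψ ψ' : F.U N), F.cls ψ = F.cls ψ' →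
      T N h ψ = T N h ψ') (s : Sec F.uSheaf V) :
    ∃ r : P.obj (op V), ∀ (N : Opens X) (h : N ≤ V) (ψ : F.U N), Sec.res h s = F.cls ψ →
      P.map (homOfLE h).op r = T N h ψ := by
  obtain ⟨r, hr⟩ := F.exists_descend₂ hP (fun N h ψ _ => T N h ψ)
    (fun N M h k ψ _ => hT N M h k ψ) (fun N h ψ ψ' _ _ e _ => hcongr N h ψ ψ' e) s s
  exact ⟨r, fun N h ψ hψ => hr N h ψ ψ hψ hψ⟩

/-! ### The bracket of `𝔲(A)` -/

theorem Ulie_skew {V : Opens X} (ψ φ : F.U V) : F.Ulie ψ φ = -F.Ulie φ ψ :=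
  Subtype.ext (neg_sub (φ.1 * ψ.1) (ψ.1 * φ.1)).symm

theorem Ulie_add_left {V : Opens X} (ψ ψ' φ : F.U V) :
    F.Ulie (ψ + ψ') φ = F.Ulie ψ φ + F.Ulie ψ' φ := by
  refine Subtype.ext ?_
  change (ψ.1 + ψ'.1) * φ.1 - φ.1 * (ψ.1 + ψ'.1) =
    (ψ.1 * φ.1 - φ.1 * ψ.1) + (ψ'.1 * φ.1 - φ.1 * ψ'.1)
  noncomm_ring

theorem Ulie_add_right {V : Opens X} (ψ φ φ' : F.U V) :
    F.Ulie ψ (φ + φ') = F.Ulie ψ φ + F.Ulie ψ φ' := by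
  rw [Ulie_skew, Ulie_add_left, neg_add, ← Ulie_skew, ← Ulie_skew]

theorem Ulie_jacobi {V : Opens X} (χ ψ φ : F.U V) :
    F.Ulie χ (F.Ulie ψ φ) + F.Ulie ψ (F.Ulie φ χ) + F.Ulie φ (F.Ulie χ ψ) = 0 := by
  obtain ⟨χ, _⟩ := χ
  obtain ⟨ψ, _⟩ := ψ
  obtain ⟨φ, _⟩ := φ
  refine Subtype.ext ?_
  change (χ * (ψ * φ - φ * ψ) - (ψ * φ - φ * ψ) * χ) +
    (ψ * (φ * χ - χ * φ) - (φ * χ - χ * φ) * ψ) + (φ * (χ * ψ - ψ * χ) - (χ * ψ - ψ * χ) * φ) = 0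
  noncomm_ring

/-- Inner derivations form an ideal: since `ψ` is a derivation, `ψ{α, β} - {α, ψβ} = {ψα, β}`. -/
theorem Ulie_ad_right {V : Opens X} (ψ : F.U V) (α : Sec A V) :
    F.Ulie ψ (F.ad V α) = F.ad V (ψ.1.1 ⟨V, Set.mem_Iic.2 le_rfl⟩ α) := by
  refine Subtype.ext (Subtype.ext (funext fun V' => AddMonoidHom.ext fun β => ?_))
  change ψ.1.1 V' (F.bracket V' (Sec.res (leOf V') α) β) -
    F.bracket V' (Sec.res (leOf V') α) (ψ.1.1 V' β) =
    F.bracket V' (Sec.res (leOf V') (ψ.1.1 ⟨V, Set.mem_Iic.2 le_rfl⟩ α)) β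
  rw [ψ.2.1, ψ.1.2.2 ⟨V, Set.mem_Iic.2 le_rfl⟩ V' (leOf V'), add_sub_cancel_right]

/-- Locally `φ = φ' + {α, -}`, and the extra term of the commutator is again inner. -/
theorem cls_Ulie_congr_right {V : Opens X} (ψ : F.U V) {φ φ' : F.U V} (e : F.cls φ = F.cls φ') :
    F.cls (F.Ulie ψ φ) = F.cls (F.Ulie ψ φ') := by
  refine Sec_ext fun x hx => ?_
  obtain ⟨N, h, hxN, α, hα⟩ := F.exists_eq_add_ad e hx
  refine ⟨N, h, hxN, ?_⟩
  have : F.cls (F.Ulie (F.Ures h ψ) (F.Ures h φ)) = F.cls (F.Ulie (F.Ures h ψ) (F.Ures h φ')) := by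
    refine (congrArg (fun χ => F.cls (F.Ulie (F.Ures h ψ) χ)) hα).trans ?_
    refine (congrArg F.cls (F.Ulie_add_right _ _ _)).trans ?_
    refine (congrArg (fun χ => F.cls (F.Ulie (F.Ures h ψ) (F.Ures h φ') + χ))
      (F.Ulie_ad_right _ α)).trans ?_
    exact F.cls_add_ad _ _
  exact (F.res_cls h (F.Ulie ψ φ)).trans (this.trans (F.res_cls h (F.Ulie ψ φ')).symm)

theorem cls_Ulie_congr {V : Opens X} {ψ ψ' φ φ' : F.U V} (e : F.cls ψ = F.cls ψ')
    (e' : F.cls φ = F.cls φ') : F.cls (F.Ulie ψ φ) = F.cls (F.Ulie ψ' φ') := by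
  rw [F.cls_Ulie_congr_right ψ e', Ulie_skew, cls_neg, F.cls_Ulie_congr_right φ' e, ← cls_neg,
    ← Ulie_skew]

theorem exists_uBracket {V : Opens X} (s t : Sec F.uSheaf V) : ∃ r : Sec F.uSheaf V,
    ∀ (N : Opens X) (h : N ≤ V) (ψ φ : F.U N), Sec.res h s = F.cls ψ → Sec.res h t = F.cls φ →
      Sec.res h r = F.cls (F.Ulie ψ φ) :=
  F.exists_descend₂ (isSheaf_forget_Sec F.uSheaf) (fun _ _ ψ φ => F.cls (F.Ulie ψ φ))
    (fun _ _ _ k ψ φ => F.res_cls k (F.Ulie ψ φ)) (fun _ _ _ _ _ _ => F.cls_Ulie_congr) s t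

/-- The bracket of two sections of `𝔲(A)`. -/
def uBracket {V : Opens X} (s t : Sec F.uSheaf V) : Sec F.uSheaf V :=
  (F.exists_uBracket s t).choose

/-- This property determines the bracket locally. With `Sec_ext` and local representatives it
reduces the identities for `uBracket` to those for commutators of operators. -/
theorem res_uBracket_of_eq_cls {V N : Opens X} (h : N ≤ V) {s t : Sec F.uSheaf V} {ψ φ : F.U N}
    (hψ : Sec.res h s = F.cls ψ) (hφ : Sec.res h t = F.cls φ) :
    Sec.res h (F.uBracket s t) = F.cls (F.Ulie ψ φ) :=
  (F.exists_uBracket s t).choose_spec N h ψ φ hψ hφ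

theorem uBracket_cls {V : Opens X} (ψ φ : F.U V) :
    F.uBracket (F.cls ψ) (F.cls φ) = F.cls (F.Ulie ψ φ) := by
  have := F.res_uBracket_of_eq_cls (le_refl V) (Sec.res_self _ (F.cls ψ))
    (Sec.res_self _ (F.cls φ))
  rwa [Sec.res_self] at this

theorem res_uBracket {V W : Opens X} (h : V ≤ W) (s t : Sec F.uSheaf W) :
    Sec.res h (F.uBracket s t) = F.uBracket (Sec.res h s) (Sec.res h t) := by
  refine Sec_ext fun x hx => ?_
  obtain ⟨N, k, hxN, ψ, φ, hψ, hφ⟩ := F.exists_cls₂ (Sec.res h s) (Sec.res h t) hx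
  refine ⟨N, k, hxN, ?_⟩
  rw [F.res_uBracket_of_eq_cls k hψ hφ, Sec.res_res]
  rw [Sec.res_res] at hψ hφ
  exact F.res_uBracket_of_eq_cls _ hψ hφ

theorem uBracket_skew {V : Opens X} (s t : Sec F.uSheaf V) :
    F.uBracket s t = -F.uBracket t s := by
  refine Sec_ext fun x hx => ?_
  obtain ⟨N, k, hxN, ψ, φ, hψ, hφ⟩ := F.exists_cls₂ s t hx
  refine ⟨N, k, hxN, ?_⟩
  rw [map_neg, F.res_uBracket_of_eq_cls k hψ hφ, F.res_uBracket_of_eq_cls k hφ hψ, Ulie_skew,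
    cls_neg]

theorem uBracket_add_left {V : Opens X} (s s' t : Sec F.uSheaf V) :
    F.uBracket (s + s') t = F.uBracket s t + F.uBracket s' t := by
  refine Sec_ext fun x hx => ?_
  obtain ⟨N, k, hxN, ψ, ψ', φ, hψ, hψ', hφ⟩ := F.exists_cls₃ s s' t hx
  refine ⟨N, k, hxN, ?_⟩
  rw [map_add, F.res_uBracket_of_eq_cls k hψ hφ, F.res_uBracket_of_eq_cls k hψ' hφ,
    F.res_uBracket_of_eq_cls k (ψ := ψ + ψ') (by rw [map_add, hψ, hψ', cls_add]) hφ,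
    Ulie_add_left, cls_add]

theorem uBracket_add_right {V : Opens X} (s t t' : Sec F.uSheaf V) :
    F.uBracket s (t + t') = F.uBracket s t + F.uBracket s t' := by
  rw [uBracket_skew, uBracket_add_left, neg_add, ← uBracket_skew, ← uBracket_skew]

theorem uBracket_jacobi {V : Opens X} (r s t : Sec F.uSheaf V) :
    F.uBracket r (F.uBracket s t) + F.uBracket s (F.uBracket t r) +
      F.uBracket t (F.uBracket r s) = 0 := by
  refine Sec_ext fun x hx => ?_
  obtain ⟨N, k, hxN, χ, ψ, φ, hχ, hψ, hφ⟩ := F.exists_cls₃ r s t hx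
  refine ⟨N, k, hxN, ?_⟩
  simp only [map_add, res_uBracket, hχ, hψ, hφ, uBracket_cls, ← cls_add, Ulie_jacobi, cls_zero,
    map_zero]

/-- The Lie bracket of `𝔲(A)`. -/
def uLie : LieBracketOn F.uSheaf where
  bracket _ := AddMonoidHom.mk' (fun s => AddMonoidHom.mk' (fun t => F.uBracket s t)
    (F.uBracket_add_right s)) fun s s' => AddMonoidHom.ext fun t => F.uBracket_add_left s s' t
  res_bracket h s t := F.res_uBracket h s t
  skew _ s t := F.uBracket_skew s t
  jacobi _ r s t := F.uBracket_jacobi r s t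

end LieAlgebroidFamily

/-! ### Symbols of sums, restrictions and multiples -/

section

variable {A : TopCat.Sheaf AddCommGrpCat.{u} X.carrier} [OModule X A]

theorem IsSymbol.add {V : Opens X} {ψ φ : LocalEnd A V} {D E : VF X V} (hD : IsSymbol ψ D)
    (hE : IsSymbol φ E) : IsSymbol (ψ + φ) (D + E) := by
  intro V' f α
  change (ψ.1 _ _ + φ.1 _ _) - _ • (ψ.1 _ _ + φ.1 _ _) = (D.1 V' f + E.1 V' f) • α
  rw [add_smul, ← hD, ← hE, smul_add]
  abel

theorem IsSymbol.res {V W : Opens X} (h : V ≤ W) {ψ : LocalEnd A W} {D : VF X W}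
    (hD : IsSymbol ψ D) : IsSymbol (LocalEnd.res h ψ) (VF.res h D) :=
  fun V' => hD ⟨V'.1, V'.2.trans h⟩

theorem IsSymbol.smul {V : Opens X} (f : O X V) {ψ : LocalEnd A V} {D : VF X V}
    (hD : IsSymbol ψ D) : IsSymbol (LocalEnd.smul f ψ) (VF.smul f D) := by
  intro V' f' α
  change LieAlgd.res (leOf V') f • ψ.1 V' _ - f' • LieAlgd.res (leOf V') f • ψ.1 V' _ =
    (LieAlgd.res (leOf V') f * D.1 V' f') • α
  rw [mul_smul, ← hD, smul_sub, smul_comm f']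

end

namespace LieAlgebroidFamily

variable {A : TopCat.Sheaf AddCommGrpCat.{u} X.carrier} [OModule X A] (F : LieAlgebroidFamily π A)

/-! ### Multiplication by functions on the base -/

variable {F} in
theorem U_ext {V : Opens X} {ψ φ : F.U V} (h : ∀ (V' : Set.Iic V) (α : Sec A V'.1),
    ψ.1.1 V' α = φ.1.1 V' α) : ψ = φ :=
  Subtype.ext (Subtype.ext (funext fun V' => AddMonoidHom.ext (h V')))

theorem Usmul_apply {V : Opens X} {W : Opens S} (h : V ≤ pre π W) (g : O S W) (ψ : F.U V)
    (V' : Set.Iic V) (α : Sec A V'.1) :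
    (F.Usmul h g ψ).1.1 V' α = res ((leOf V').trans h) (pull π W g) • ψ.1.1 V' α := by
  change res (leOf V') (res h (pull π W g)) • ψ.1.1 V' α = _
  rw [res_res]

theorem Ures_Usmul {V V' : Opens X} {W : Opens S} (k : V' ≤ V) (h : V ≤ pre π W) (g : O S W)
    (ψ : F.U V) : F.Ures k (F.Usmul h g ψ) = F.Usmul (k.trans h) g (F.Ures k ψ) :=
  U_ext fun N α => (F.Usmul_apply h g ψ ⟨N.1, N.2.trans k⟩ α).trans
    (F.Usmul_apply (k.trans h) g (F.Ures k ψ) N α).symm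

theorem Usmul_res {V : Opens X} {W W' : Opens S} (h : V ≤ pre π W') (k : W' ≤ W) (g : O S W)
    (ψ : F.U V) : F.Usmul h (res k g) ψ = F.Usmul (h.trans (pre_mono π k)) g ψ :=
  U_ext fun N α => by rw [Usmul_apply, Usmul_apply, pull_res, res_res]

theorem Usmul_add {V : Opens X} {W : Opens S} (h : V ≤ pre π W) (g : O S W) (ψ φ : F.U V) :
    F.Usmul h g (ψ + φ) = F.Usmul h g ψ + F.Usmul h g φ :=
  U_ext fun N α => by
    change _ = (F.Usmul h g ψ).1.1 N α + (F.Usmul h g φ).1.1 N α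
    rw [Usmul_apply, Usmul_apply, Usmul_apply, ← smul_add]
    rfl

theorem add_Usmul {V : Opens X} {W : Opens S} (h : V ≤ pre π W) (g g' : O S W) (ψ : F.U V) :
    F.Usmul h (g + g') ψ = F.Usmul h g ψ + F.Usmul h g' ψ :=
  U_ext fun N α => by
    change _ = (F.Usmul h g ψ).1.1 N α + (F.Usmul h g' ψ).1.1 N α
    rw [Usmul_apply, Usmul_apply, Usmul_apply, map_add, map_add, add_smul]

theorem mul_Usmul {V : Opens X} {W : Opens S} (h : V ≤ pre π W) (g g' : O S W) (ψ : F.U V) :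
    F.Usmul h (g * g') ψ = F.Usmul h g (F.Usmul h g' ψ) :=
  U_ext fun N α => by
    rw [Usmul_apply, Usmul_apply, Usmul_apply, map_mul, map_mul, mul_smul]

theorem one_Usmul {V : Opens X} {W : Opens S} (h : V ≤ pre π W) (ψ : F.U V) :
    F.Usmul h 1 ψ = ψ :=
  U_ext fun N α => by rw [Usmul_apply, map_one, map_one, one_smul]

/-- Here bilinearity over `π⁻¹𝒪_S` is essential: for a general function `f` on `X`, the operators
`f{α, -}` and `{fα, -}` differ by `β ↦ a(β)(f)α`. -/
theorem Usmul_ad {V : Opens X} {W : Opens S} (h : V ≤ pre π W) (g : O S W) (α : Sec A V) :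
    F.Usmul h g (F.ad V α) = F.ad V (res h (pull π W g) • α) :=
  U_ext fun N β => by
    rw [Usmul_apply]
    change res _ (pull π W g) • F.bracket N.1 (Sec.res (leOf N) α) β =
      F.bracket N.1 (Sec.res (leOf N) (res h (pull π W g) • α)) β
    rw [OModule.res_smul, res_res, F.bracket_smul]

/-- From `φ(gψα) = gφ(ψα) + D(g)ψα`. The function `g'` on the base with `D(g ∘ π) = g' ∘ π` is part
of the data, so that the last term is again a multiple by a function from `S`. -/
theorem Ulie_Usmul {V : Opens X} {W : Opens S} (h : V ≤ pre π W) {g g' : O S W} (ψ : F.U V)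
    {φ : F.U V} {D : VF X V} (hD : IsSymbol φ.1 D)
    (hg : D.1 ⟨V, Set.mem_Iic.2 le_rfl⟩ (res h (pull π W g)) = res h (pull π W g')) :
    F.Ulie (F.Usmul h g ψ) φ = F.Usmul h g (F.Ulie ψ φ) - F.Usmul h g' ψ :=
  U_ext fun N α => by
    change (F.Usmul h g ψ).1.1 N (φ.1.1 N α) - φ.1.1 N ((F.Usmul h g ψ).1.1 N α) =
      (F.Usmul h g (F.Ulie ψ φ)).1.1 N α - (F.Usmul h g' ψ).1.1 N α
    have e := D.2 ⟨V, Set.mem_Iic.2 le_rfl⟩ N (leOf N) (res h (pull π W g))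
    rw [hg, res_res, res_res] at e
    rw [Usmul_apply, Usmul_apply, Usmul_apply, Usmul_apply, hD.apply, e]
    change _ = _ • (ψ.1.1 N (φ.1.1 N α) - φ.1.1 N (ψ.1.1 N α)) - _
    rw [smul_sub, sub_sub]

theorem cls_Usmul_congr {V : Opens X} {W : Opens S} (h : V ≤ pre π W) (g : O S W) {ψ φ : F.U V}
    (e : F.cls ψ = F.cls φ) : F.cls (F.Usmul h g ψ) = F.cls (F.Usmul h g φ) := by
  refine Sec_ext fun x hx => ?_
  obtain ⟨N, k, hxN, α, hα⟩ := F.exists_eq_add_ad e hx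
  refine ⟨N, k, hxN, ?_⟩
  have hr : ∀ χ : F.U V, Sec.res k (F.cls (F.Usmul h g χ)) =
      F.cls (F.Usmul (k.trans h) g (F.Ures k χ)) := fun χ =>
    (F.res_cls k _).trans (congrArg F.cls (F.Ures_Usmul k h g χ))
  refine (hr ψ).trans (Eq.trans ?_ (hr φ).symm)
  refine (congrArg (fun χ => F.cls (F.Usmul (k.trans h) g χ)) hα).trans ?_
  refine (congrArg F.cls (F.Usmul_add _ _ _ _)).trans ?_
  refine (congrArg (fun χ => F.cls (F.Usmul (k.trans h) g (F.Ures k φ) + χ))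
    (F.Usmul_ad _ g α)).trans ?_
  exact F.cls_add_ad _ _

theorem exists_uSmul {V : Opens X} {W : Opens S} (h : V ≤ pre π W) (g : O S W)
    (s : Sec F.uSheaf V) : ∃ r : Sec F.uSheaf V, ∀ (N : Opens X) (k : N ≤ V) (ψ : F.U N),
      Sec.res k s = F.cls ψ → Sec.res k r = F.cls (F.Usmul (k.trans h) g ψ) :=
  F.exists_descend (isSheaf_forget_Sec F.uSheaf) (fun _ k ψ => F.cls (F.Usmul (k.trans h) g ψ))
    (fun _ _ k l ψ => (F.res_cls l _).trans (congrArg F.cls (F.Ures_Usmul l (k.trans h) g ψ)))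
    (fun _ k _ _ => F.cls_Usmul_congr (k.trans h) g) s

/-- The product of a function on `W` and a section of `𝔲(A)` over `V ⊆ π⁻¹W`. -/
def uSmul {V : Opens X} {W : Opens S} (h : V ≤ pre π W) (g : O S W) (s : Sec F.uSheaf V) :
    Sec F.uSheaf V :=
  (F.exists_uSmul h g s).choose

theorem res_uSmul_of_eq_cls {V N : Opens X} {W : Opens S} (h : V ≤ pre π W) (g : O S W)
    {s : Sec F.uSheaf V} (k : N ≤ V) {ψ : F.U N} (e : Sec.res k s = F.cls ψ) :
    Sec.res k (F.uSmul h g s) = F.cls (F.Usmul (k.trans h) g ψ) :=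
  (F.exists_uSmul h g s).choose_spec N k ψ e

theorem res_uSmul {V V' : Opens X} {W : Opens S} (h : V ≤ pre π W) (g : O S W)
    (s : Sec F.uSheaf V) (k : V' ≤ V) :
    Sec.res k (F.uSmul h g s) = F.uSmul (k.trans h) g (Sec.res k s) := by
  refine Sec_ext fun x hx => ?_
  obtain ⟨N, l, hxN, ψ, e⟩ := F.exists_cls (Sec.res k s) hx
  refine ⟨N, l, hxN, ?_⟩
  rw [F.res_uSmul_of_eq_cls _ g l e, Sec.res_res]
  rw [Sec.res_res] at e
  exact F.res_uSmul_of_eq_cls h g _ e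

theorem uSmul_res {V : Opens X} {W W' : Opens S} (h : V ≤ pre π W') (k : W' ≤ W) (g : O S W)
    (s : Sec F.uSheaf V) : F.uSmul h (res k g) s = F.uSmul (h.trans (pre_mono π k)) g s := by
  refine Sec_ext fun x hx => ?_
  obtain ⟨N, l, hxN, ψ, e⟩ := F.exists_cls s hx
  refine ⟨N, l, hxN, ?_⟩
  rw [F.res_uSmul_of_eq_cls _ _ l e, F.res_uSmul_of_eq_cls _ _ l e, Usmul_res]

section

variable {V : Opens X} {W : Opens S} (h : V ≤ pre π W)

theorem uSmul_add (g : O S W) (s t : Sec F.uSheaf V) :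
    F.uSmul h g (s + t) = F.uSmul h g s + F.uSmul h g t := by
  refine Sec_ext fun x hx => ?_
  obtain ⟨N, k, hxN, ψ, φ, hψ, hφ⟩ := F.exists_cls₂ s t hx
  refine ⟨N, k, hxN, ?_⟩
  rw [map_add, F.res_uSmul_of_eq_cls h g k hψ, F.res_uSmul_of_eq_cls h g k hφ,
    F.res_uSmul_of_eq_cls h g k (ψ := ψ + φ) (by rw [map_add, hψ, hφ, cls_add]),
    Usmul_add, cls_add]

theorem add_uSmul (g g' : O S W) (s : Sec F.uSheaf V) :
    F.uSmul h (g + g') s = F.uSmul h g s + F.uSmul h g' s := by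
  refine Sec_ext fun x hx => ?_
  obtain ⟨N, k, hxN, ψ, e⟩ := F.exists_cls s hx
  refine ⟨N, k, hxN, ?_⟩
  rw [map_add, F.res_uSmul_of_eq_cls h _ k e, F.res_uSmul_of_eq_cls h _ k e,
    F.res_uSmul_of_eq_cls h _ k e, add_Usmul, cls_add]

theorem mul_uSmul (g g' : O S W) (s : Sec F.uSheaf V) :
    F.uSmul h (g * g') s = F.uSmul h g (F.uSmul h g' s) := by
  refine Sec_ext fun x hx => ?_
  obtain ⟨N, k, hxN, ψ, e⟩ := F.exists_cls s hx
  refine ⟨N, k, hxN, ?_⟩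
  rw [F.res_uSmul_of_eq_cls h _ k e,
    F.res_uSmul_of_eq_cls h g k (F.res_uSmul_of_eq_cls h g' k e), mul_Usmul]

theorem one_uSmul (s : Sec F.uSheaf V) : F.uSmul h 1 s = s := by
  refine Sec_ext fun x hx => ?_
  obtain ⟨N, k, hxN, ψ, e⟩ := F.exists_cls s hx
  refine ⟨N, k, hxN, ?_⟩
  rw [F.res_uSmul_of_eq_cls h _ k e, one_Usmul, e]

/-- The module structure on the sections of `𝔲(A)` over `V ⊆ π⁻¹W`. -/
abbrev uModule : Module (O S W) (Sec F.uSheaf V) where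
  smul := F.uSmul h
  one_smul := F.one_uSmul h
  mul_smul := F.mul_uSmul h
  smul_zero g := (AddMonoidHom.mk' (F.uSmul h g) (F.uSmul_add h g)).map_zero
  smul_add := F.uSmul_add h
  add_smul := F.add_uSmul h
  zero_smul s :=
    (AddMonoidHom.mk' (fun g => F.uSmul h g s) fun g g' => F.add_uSmul h g g' s).map_zero

end

/-- The `𝒪_S`-module structure of `π_* 𝔲(A)`. -/
abbrev pushModule : OModule S F.pushU where
  module _ := F.uModule le_rfl
  res_smul {V W} h f s := (F.res_uSmul (le_refl (pre π W)) f s (pre_mono π h)).trans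
    (F.uSmul_res (le_refl (pre π V)) h f (Sec.res (pre_mono π h) (F.ofPush s))).symm

end LieAlgebroidFamily

namespace LieAlgebroidFamily

variable {A : TopCat.Sheaf AddCommGrpCat.{u} X.carrier} [OModule X A] (F : LieAlgebroidFamily π A)

/-! ### The symbol of sections of `𝔲(A)` -/

/-- A symbol of a section of `U`. -/
def symbol {V : Opens X} (ψ : F.U V) : VF X V := ψ.2.2.2.choose

theorem isSymbol_symbol {V : Opens X} (ψ : F.U V) : IsSymbol ψ.1 (F.symbol ψ) :=
  ψ.2.2.2.choose_spec.1

theorem symbol_isBasic {V : Opens X} (ψ : F.U V) : (projVF π (F.symbol ψ)).IsBasic :=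
  ψ.2.2.2.choose_spec.2

/-- The anchor is vertical. `anchor_relative` gives this over `V ⊓ pre π W`, and the value is then
restricted to `V`. -/
theorem anchor_apply_pull {V : Opens X} {W : Opens S} (h : V ≤ pre π W) (α : Sec A V)
    (g : O S W) : (F.anchor V α).1 ⟨V, Set.mem_Iic.2 le_rfl⟩ (res h (pull π W g)) = 0 := by
  have e := (F.anchor V α).2 ⟨V ⊓ pre π W, Set.mem_Iic.2 inf_le_left⟩
    ⟨V, Set.mem_Iic.2 le_rfl⟩ (le_inf le_rfl h) (res inf_le_right (pull π W g))
  rw [res_res] at e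
  exact e.trans ((congrArg (res _) (F.anchor_relative V α W g)).trans (map_zero _))

variable (hA : IsFaithful X A)

include hA in
-- Adding `{α, -}` to an operator adds the anchor of `α` to its symbol, and the anchor kills
-- functions from `S`. Thus the symbol of a class is meaningful on such functions, though not on all
-- of `𝒪_X`.
theorem symbol_apply_congr {V : Opens X} {W : Opens S} (h : V ≤ pre π W) (g : O S W)
    {ψ φ : F.U V} (e : F.cls ψ = F.cls φ) {D E : VF X V} (hD : IsSymbol ψ.1 D)
    (hE : IsSymbol φ.1 E) : D.1 ⟨V, Set.mem_Iic.2 le_rfl⟩ (res h (pull π W g)) =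
      E.1 ⟨V, Set.mem_Iic.2 le_rfl⟩ (res h (pull π W g)) := by
  refine O_ext fun x hx => ?_
  obtain ⟨N, k, hxN, α, hα⟩ := F.exists_eq_add_ad e hx
  refine ⟨N, k, hxN, ?_⟩
  have h₁ : IsSymbol (F.Ures k ψ).1 (VF.res k E + F.anchor N α) := by
    rw [hα]
    exact (hE.res k).add (F.isSymbol_adEnd α)
  have h₂ : VF.res k D = VF.res k E + F.anchor N α := isSymbol_unique hA (hD.res k) h₁
  have h₃ := congrArg (fun Y : VF X N => Y.1 ⟨N, Set.mem_Iic.2 le_rfl⟩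
    (res (k.trans h) (pull π W g))) h₂
  have h₄ : (VF.res k E + F.anchor N α).1 ⟨N, Set.mem_Iic.2 le_rfl⟩
      (res (k.trans h) (pull π W g)) = (VF.res k E).1 ⟨N, Set.mem_Iic.2 le_rfl⟩
      (res (k.trans h) (pull π W g)) + (F.anchor N α).1 ⟨N, Set.mem_Iic.2 le_rfl⟩
      (res (k.trans h) (pull π W g)) := rfl
  rw [F.anchor_apply_pull, add_zero] at h₄
  have h₅ := D.2 ⟨V, Set.mem_Iic.2 le_rfl⟩ ⟨N, k⟩ k (res h (pull π W g))
  have h₆ := E.2 ⟨V, Set.mem_Iic.2 le_rfl⟩ ⟨N, k⟩ k (res h (pull π W g))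
  rw [res_res] at h₅ h₆
  exact h₅.symm.trans ((h₃.trans h₄).trans h₆)

include hA in
theorem exists_uSymbol {V : Opens X} {W : Opens S} (h : V ≤ pre π W) (s : Sec F.uSheaf V)
    (g : O S W) : ∃ r : O X V, ∀ (N : Opens X) (k : N ≤ V) (ψ : F.U N),
      Sec.res k s = F.cls ψ → res k r =
        (F.symbol ψ).1 ⟨N, Set.mem_Iic.2 le_rfl⟩ (res (k.trans h) (pull π W g)) :=
  F.exists_descend (isSheaf_forget_O X)
    (fun N k ψ => (F.symbol ψ).1 ⟨N, Set.mem_Iic.2 le_rfl⟩ (res (k.trans h) (pull π W g)))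
    (fun N M k l ψ => by
      have e := (F.symbol ψ).2 ⟨N, Set.mem_Iic.2 le_rfl⟩ ⟨M, l⟩ l (res (k.trans h) (pull π W g))
      rw [res_res] at e
      -- Symbols are chosen separately for `ψ` and its restriction; the restricted symbol and the
      -- newly chosen one have the same values on pullbacks.
      exact e.symm.trans (F.symbol_apply_congr hA ((l.trans k).trans h) g
        (rfl : F.cls (F.Ures l ψ) = _) ((F.isSymbol_symbol ψ).res l) (F.isSymbol_symbol _)))
    (fun _ k ψ ψ' e => F.symbol_apply_congr hA (k.trans h) g e (F.isSymbol_symbol ψ)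
      (F.isSymbol_symbol ψ')) s

/-- The value on the pullback of a function `g` on `W` of the symbol of a section of `𝔲(A)` over
`V ⊆ π⁻¹W`. -/
def uSymbol {V : Opens X} {W : Opens S} (h : V ≤ pre π W) (s : Sec F.uSheaf V)
    (g : O S W) : O X V :=
  (F.exists_uSymbol hA h s g).choose

/-- Any symbol `D` of a representative may be used, which allows sums, multiples and restrictions of
the chosen ones below. -/
theorem res_uSymbol_of_eq_cls {V N : Opens X} {W : Opens S} (h : V ≤ pre π W)
    {s : Sec F.uSheaf V} (g : O S W) (k : N ≤ V) {ψ : F.U N} (e : Sec.res k s = F.cls ψ)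
    {D : VF X N} (hD : IsSymbol ψ.1 D) : res k (F.uSymbol hA h s g) =
      D.1 ⟨N, Set.mem_Iic.2 le_rfl⟩ (res (k.trans h) (pull π W g)) :=
  ((F.exists_uSymbol hA h s g).choose_spec N k ψ e).trans
    (F.symbol_apply_congr hA (k.trans h) g rfl (F.isSymbol_symbol ψ) hD)

theorem res_uSymbol {V V' : Opens X} {W : Opens S} (h : V ≤ pre π W) (s : Sec F.uSheaf V)
    (g : O S W) (k : V' ≤ V) :
    res k (F.uSymbol hA h s g) = F.uSymbol hA (k.trans h) (Sec.res k s) g := by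
  refine O_ext fun x hx => ?_
  obtain ⟨N, l, hxN, ψ, e⟩ := F.exists_cls (Sec.res k s) hx
  refine ⟨N, l, hxN, ?_⟩
  rw [F.res_uSymbol_of_eq_cls hA _ g l e (F.isSymbol_symbol ψ), res_res]
  rw [Sec.res_res] at e
  exact F.res_uSymbol_of_eq_cls hA h g _ e (F.isSymbol_symbol ψ)

theorem uSymbol_cls {V : Opens X} {W : Opens S} (h : V ≤ pre π W) {ψ : F.U V} (g : O S W)
    {D : VF X V} (hD : IsSymbol ψ.1 D) : F.uSymbol hA h (F.cls ψ) g =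
      D.1 ⟨V, Set.mem_Iic.2 le_rfl⟩ (res h (pull π W g)) := by
  have := F.res_uSymbol_of_eq_cls hA h g le_rfl (Sec.res_self _ (F.cls ψ)) hD
  rwa [res_self] at this

theorem uSymbol_res {V : Opens X} {W W' : Opens S} (h : V ≤ pre π W') (k : W' ≤ W)
    (s : Sec F.uSheaf V) (g : O S W) :
    F.uSymbol hA h s (res k g) = F.uSymbol hA (h.trans (pre_mono π k)) s g := by
  refine O_ext fun x hx => ?_
  obtain ⟨N, l, hxN, ψ, e⟩ := F.exists_cls s hx
  refine ⟨N, l, hxN, ?_⟩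
  rw [F.res_uSymbol_of_eq_cls hA _ _ l e (F.isSymbol_symbol ψ),
    F.res_uSymbol_of_eq_cls hA _ _ l e (F.isSymbol_symbol ψ), pull_res, res_res]

section

variable {V : Opens X} {W : Opens S} (h : V ≤ pre π W)

theorem uSymbol_add (s : Sec F.uSheaf V) (g g' : O S W) :
    F.uSymbol hA h s (g + g') = F.uSymbol hA h s g + F.uSymbol hA h s g' := by
  refine O_ext fun x hx => ?_
  obtain ⟨N, l, hxN, ψ, e⟩ := F.exists_cls s hx
  refine ⟨N, l, hxN, ?_⟩
  have H := fun g => F.res_uSymbol_of_eq_cls hA h g l e (F.isSymbol_symbol ψ)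
  simp only [map_add, H]

theorem uSymbol_smul (s : Sec F.uSheaf V) (c : ℂ) (g : O S W) :
    F.uSymbol hA h s (c • g) = c • F.uSymbol hA h s g := by
  refine O_ext fun x hx => ?_
  obtain ⟨N, l, hxN, ψ, e⟩ := F.exists_cls s hx
  refine ⟨N, l, hxN, ?_⟩
  have H := fun g => F.res_uSymbol_of_eq_cls hA h g l e (F.isSymbol_symbol ψ)
  simp only [map_smul, Derivation.map_smul, H]

theorem uSymbol_mul (s : Sec F.uSheaf V) (g g' : O S W) :
    F.uSymbol hA h s (g * g') = res h (pull π W g) * F.uSymbol hA h s g' +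
      res h (pull π W g') * F.uSymbol hA h s g := by
  refine O_ext fun x hx => ?_
  obtain ⟨N, l, hxN, ψ, e⟩ := F.exists_cls s hx
  refine ⟨N, l, hxN, ?_⟩
  have H := fun g => F.res_uSymbol_of_eq_cls hA h g l e (F.isSymbol_symbol ψ)
  simp only [map_add, map_mul, Derivation.leibniz, smul_eq_mul, H, res_res]

theorem add_uSymbol (s t : Sec F.uSheaf V) (g : O S W) :
    F.uSymbol hA h (s + t) g = F.uSymbol hA h s g + F.uSymbol hA h t g := by
  refine O_ext fun x hx => ?_
  obtain ⟨N, k, hxN, ψ, φ, hψ, hφ⟩ := F.exists_cls₂ s t hx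
  refine ⟨N, k, hxN, ?_⟩
  rw [map_add, F.res_uSymbol_of_eq_cls hA h g k hψ (F.isSymbol_symbol ψ),
    F.res_uSymbol_of_eq_cls hA h g k hφ (F.isSymbol_symbol φ)]
  exact F.res_uSymbol_of_eq_cls hA h g k (ψ := ψ + φ) (by rw [map_add, hψ, hφ, cls_add])
    ((F.isSymbol_symbol ψ).add (F.isSymbol_symbol φ))

theorem uSymbol_uSmul {W' : Opens S} (h' : V ≤ pre π W') (f : O S W') (s : Sec F.uSheaf V)
    (g : O S W) : F.uSymbol hA h (F.uSmul h' f s) g =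
      res h' (pull π W' f) * F.uSymbol hA h s g := by
  refine O_ext fun x hx => ?_
  obtain ⟨N, k, hxN, ψ, e⟩ := F.exists_cls s hx
  refine ⟨N, k, hxN, ?_⟩
  rw [map_mul, F.res_uSymbol_of_eq_cls hA h g k e (F.isSymbol_symbol ψ)]
  refine (F.res_uSymbol_of_eq_cls hA h g k (F.res_uSmul_of_eq_cls h' f k e)
    ((F.isSymbol_symbol ψ).smul (res (k.trans h') (pull π W' f)))).trans ?_
  change res _ (res _ _) * _ = _
  rw [res_res, res_res]
  rfl

/-- The Leibniz rule before the anchor is available: `g'` stands for the value on `g` of the anchor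
of `t`. -/
theorem uBracket_uSmul (g g' : O S W) (s t : Sec F.uSheaf V)
    (hg : F.uSymbol hA h t g = res h (pull π W g')) :
    F.uBracket (F.uSmul h g s) t = F.uSmul h g (F.uBracket s t) - F.uSmul h g' s := by
  refine Sec_ext fun x hx => ?_
  obtain ⟨N, k, hxN, ψ, φ, hψ, hφ⟩ := F.exists_cls₂ s t hx
  refine ⟨N, k, hxN, ?_⟩
  have e := congrArg (res k) hg
  rw [F.res_uSymbol_of_eq_cls hA h g k hφ (F.isSymbol_symbol φ), res_res] at e
  rw [F.res_uBracket_of_eq_cls k (F.res_uSmul_of_eq_cls h g k hψ) hφ, map_sub,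
    F.res_uSmul_of_eq_cls h g k (F.res_uBracket_of_eq_cls k hψ hφ),
    F.res_uSmul_of_eq_cls h g' k hψ, F.Ulie_Usmul _ ψ (F.isSymbol_symbol φ) e, cls_sub]

end

/-- The morphism `𝔲(A) → π⁻¹ T_S` induced by the symbol. -/
def uAnchor (V : Opens X) (s : Sec F.uSheaf V) : BasicVF π V :=
  ⟨{ toFun := fun W =>
        { toFun := F.uSymbol hA inf_le_right (Sec.res inf_le_left s)
          map_add' := F.uSymbol_add hA inf_le_right _
          map_smul' := F.uSymbol_smul hA inf_le_right _ }
     leibniz := fun _ => F.uSymbol_mul hA inf_le_right _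
     naturality := fun h g => (F.uSymbol_res hA inf_le_right h _ g).trans (by
        refine Eq.trans ?_ (F.res_uSymbol hA inf_le_right _ g _).symm
        rw [Sec.res_res]) }, fun x hx => by
    obtain ⟨N, k, hxN, ψ, e⟩ := F.exists_cls s hx
    -- Being basic is a local condition, inherited from the symbol of a representative near `x`.
    obtain ⟨Z, Y, M, hxZ, hxM, H⟩ := F.symbol_isBasic ψ x hxN
    refine ⟨Z, Y, N ⊓ M, hxZ, ⟨hxN, hxM⟩, ?_⟩
    rw [projVF_agreesOn_iff] at H
    rw [DerAlong.agreesOn_iff]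
    intro W' h g L h₁ h₂
    have hL : L ≤ N := h₁.trans inf_le_left
    refine Eq.trans ?_ (H W' h g L (h₁.trans inf_le_right) hL (h₂.trans inf_le_right))
    refine F.res_uSymbol_of_eq_cls hA inf_le_right g h₂ (ψ := F.Ures hL ψ) ?_
      ((F.isSymbol_symbol ψ).res hL)
    rw [Sec.res_res]
    exact F.res_eq_cls_Ures e hL⟩

theorem uAnchor_toFun {V : Opens X} (s : Sec F.uSheaf V) (W : Opens S) (g : O S W) :
    (F.uAnchor hA V s).1.toFun W g = F.uSymbol hA inf_le_right (Sec.res inf_le_left s) g := rfl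

theorem res_uAnchor {V V' : Opens X} (h : V' ≤ V) (s : Sec F.uSheaf V) :
    F.uAnchor hA V' (Sec.res h s) = (F.uAnchor hA V s).res h := by
  refine Subtype.ext (DerAlong.ext (funext fun W => LinearMap.ext fun g => ?_))
  refine Eq.trans ?_ (F.res_uSymbol hA inf_le_right (Sec.res inf_le_left s) g
    (inf_le_inf_right (pre π W) h)).symm
  rw [uAnchor_toFun, Sec.res_res, Sec.res_res]

theorem uAnchor_cls {V : Opens X} {ψ : F.U V} {D : VF X V} (hD : IsSymbol ψ.1 D) :
    (F.uAnchor hA V (F.cls ψ)).1 = projVF π D := by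
  refine DerAlong.ext (funext fun W => LinearMap.ext fun g => ?_)
  rw [uAnchor_toFun]
  exact (congrArg (fun t => F.uSymbol hA inf_le_right t g)
    (F.res_cls inf_le_left ψ)).trans (F.uSymbol_cls hA inf_le_right (ψ := F.Ures inf_le_left ψ)
      g (hD.res inf_le_left))

/-! ### The Lie algebroid `π_* 𝔲(A)` -/

section

variable (hbij : ∀ W : Opens S, Function.Bijective (pullVF π W))

/-- The anchor of `π_* 𝔲(A)`. -/
def pushAnchor (W : Opens S) (s : Sec F.pushU W) : VF S W :=
  (Equiv.ofBijective _ (hbij W)).symm (F.uAnchor hA (pre π W) (F.ofPush s))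

theorem pullVF_pushAnchor (W : Opens S) (s : Sec F.pushU W) :
    pullVF π W (F.pushAnchor hA hbij W s) = F.uAnchor hA (pre π W) (F.ofPush s) :=
  (Equiv.ofBijective _ (hbij W)).apply_symm_apply _

/-- The working description of the anchor: its values are known after pullback, so by injectivity of
`pull` its properties follow from those of `uSymbol`. -/
theorem pull_pushAnchor {W : Opens S} (s : Sec F.pushU W) (W' : Set.Iic W) (g : O S W'.1) :
    pull π W'.1 ((F.pushAnchor hA hbij W s).1 W' g) =
      F.uSymbol hA le_rfl (Sec.res (pre_mono π (leOf W')) (F.ofPush s)) g := by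
  have e := congrArg (fun δ => res (le_inf (pre_mono π (leOf W')) le_rfl) (δ.1.toFun W'.1 g))
    (F.pullVF_pushAnchor hA hbij W s)
  simp only [pullVF_toFun π _ (leOf W'), res_res, res_self, uAnchor_toFun, res_uSymbol,
    Sec.res_res] at e
  exact e

variable (hinj : ∀ W : Opens S, Function.Injective (pull π W))

include hinj in
theorem VF_ext_of_pull {W : Opens S} {Y Z : VF S W}
    (h : ∀ (W' : Set.Iic W) (g : O S W'.1), pull π W'.1 (Y.1 W' g) = pull π W'.1 (Z.1 W' g)) :
    Y = Z :=
  Subtype.ext (funext fun W' => Derivation.ext fun g => hinj _ (h W' g))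

include hinj in
theorem pushAnchor_add {W : Opens S} (s t : Sec F.pushU W) : F.pushAnchor hA hbij W (s + t) =
    F.pushAnchor hA hbij W s + F.pushAnchor hA hbij W t := by
  refine VF_ext_of_pull hinj fun W' g => ?_
  have e : pull π W'.1 ((F.pushAnchor hA hbij W s + F.pushAnchor hA hbij W t).1 W' g) =
      pull π W'.1 ((F.pushAnchor hA hbij W s).1 W' g) +
      pull π W'.1 ((F.pushAnchor hA hbij W t).1 W' g) := map_add (pull π W'.1) _ _
  rw [e, pull_pushAnchor, pull_pushAnchor, pull_pushAnchor, ← add_uSymbol, ← map_add]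
  rfl

include hinj in
theorem res_pushAnchor {W W' : Opens S} (h : W' ≤ W) (s : Sec F.pushU W) :
    F.pushAnchor hA hbij W' (Sec.res h s) = VF.res h (F.pushAnchor hA hbij W s) := by
  refine VF_ext_of_pull hinj fun Z g => ?_
  refine (F.pull_pushAnchor hA hbij _ Z g).trans
    (Eq.trans ?_ (F.pull_pushAnchor hA hbij s ⟨Z.1, Z.2.trans h⟩ g).symm)
  exact congrArg (fun t => F.uSymbol hA le_rfl t g)
    (Sec.res_res (pre_mono π (leOf Z)) (pre_mono π h) (F.ofPush s))

include hinj in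
theorem pushAnchor_uSmul {W : Opens S} (g : O S W) (s : Sec F.pushU W) :
    F.pushAnchor hA hbij W (F.uSmul (le_refl (pre π W)) g (F.ofPush s)) =
      VF.smul g (F.pushAnchor hA hbij W s) := by
  refine VF_ext_of_pull hinj fun Z f => ?_
  have e : pull π Z.1 ((VF.smul g (F.pushAnchor hA hbij W s)).1 Z f) =
      pull π Z.1 (res (leOf Z) g) * pull π Z.1 ((F.pushAnchor hA hbij W s).1 Z f) :=
    map_mul (pull π Z.1) _ _
  rw [e, pull_pushAnchor, pull_res]
  refine (F.pull_pushAnchor hA hbij _ Z f).trans ?_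
  refine (congrArg (fun t => F.uSymbol hA le_rfl t f) (F.res_uSmul (le_refl (pre π W)) g
    (F.ofPush s) (pre_mono π (leOf Z)))).trans ?_
  exact F.uSymbol_uSmul hA le_rfl _ g _ f

theorem uBracket_pushAnchor {W : Opens S} (g : O S W) (s t : Sec F.pushU W) :
    F.uBracket (F.uSmul (le_refl (pre π W)) g (F.ofPush s)) (F.ofPush t) =
      F.uSmul le_rfl g (F.uBracket (F.ofPush s) (F.ofPush t)) - F.uSmul le_rfl
        ((F.pushAnchor hA hbij W t).1 ⟨W, Set.mem_Iic.2 le_rfl⟩ g) (F.ofPush s) := by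
  refine F.uBracket_uSmul hA le_rfl g _ _ _ ?_
  rw [res_self]
  refine Eq.trans ?_ (F.pull_pushAnchor hA hbij t ⟨W, Set.mem_Iic.2 le_rfl⟩ g).symm
  rw [Sec.res_self]

attribute [local instance] pushModule in
include hinj in
/-- The Lie algebroid structure of `π_* 𝔲(A)`. -/
def pushLie : LieAlgebroidOn S F.pushU where
  bracket W := F.uLie.bracket (pre π W)
  res_bracket h := F.uLie.res_bracket (pre_mono π h)
  skew W := F.uLie.skew (pre π W)
  jacobi W := F.uLie.jacobi (pre π W)
  bracket_smul W c s t := by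
    -- Linearity over `ℂ` is the Leibniz rule for a constant function, which the anchor kills.
    refine (F.uBracket_pushAnchor hA hbij (algebraMap ℂ (O S W) c) s t).trans ?_
    rw [Derivation.map_algebraMap]
    exact (congrArg (_ - ·) ((F.uModule (le_refl (pre π W))).zero_smul s)).trans (sub_zero _)
  anchor W := AddMonoidHom.mk' (F.pushAnchor hA hbij W) (F.pushAnchor_add hA hbij hinj)
  res_anchor h s := F.res_pushAnchor hA hbij hinj h s
  anchor_smul _ g s := F.pushAnchor_uSmul hA hbij hinj g s
  leibniz _ g s t := F.uBracket_pushAnchor hA hbij g s t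

end

end LieAlgebroidFamily

end LieAlgd

end

/-! ### The main theorem -/

theorem mainTheorem4 {X S : CSpace.{u}} (hX : IsAnalyticSpace X) (hS : IsAnalyticSpace S)
    (π : X ⟶ S) (hsmooth : IsSmoothMorphism π) (hproper : IsProperMap π.hom.base)
    (hconn : ∀ s : S, IsConnected (π.hom.base ⁻¹' {s}))
    (A : TopCat.Sheaf AddCommGrpCat.{u} X.carrier) [OModule X A] (hA : IsFaithful X A)
    (F : LieAlgebroidFamily π A) :
    -- the natural map `T_S → π_* π⁻¹ T_S` is an isomorphism
    (∀ W : Opens S, Function.Bijective (pullVF π W)) ∧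
    -- the Lie bracket of `𝔲(A)` and the symbol map `𝔲(A) → π⁻¹ T_S`
    ∃ (b : LieBracketOn F.uSheaf) (σ : ∀ V : Opens X, Sec F.uSheaf V → BasicVF π V),
      (∀ (V : Opens X) (ψ φ : F.U V),
        b.bracket V (F.cls ψ) (F.cls φ) = F.cls (F.Ulie ψ φ)) ∧
      (∀ (V V' : Opens X) (h : V' ≤ V) (s : Sec F.uSheaf V),
        σ V' (Sec.res h s) = (σ V s).res h) ∧
      (∀ (V : Opens X) (ψ : F.U V) (D : VF X V), IsSymbol ψ.1 D →
        (σ V (F.cls ψ)).1 = projVF π D) ∧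
      -- the Lie algebroid structure on `π_* 𝔲(A)`
      ∃ (_ : OModule S F.pushU) (L : LieAlgebroidOn S F.pushU),
        (∀ (W : Opens S) (g : O S W) (s : Sec F.pushU W) (V : Opens X) (h : V ≤ pre π W)
          (ψ : F.U V), Sec.res h (F.ofPush s) = F.cls ψ →
            Sec.res h (F.ofPush (g • s)) = F.cls (F.Usmul h g ψ)) ∧
        (∀ (W : Opens S) (s t : Sec F.pushU W), F.ofPush (L.bracket W s t) =
          b.bracket (pre π W) (F.ofPush s) (F.ofPush t)) ∧
        ∀ (W : Opens S) (s : Sec F.pushU W),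
          pullVF π W (L.anchor W s) = σ (pre π W) (F.ofPush s) := by
  have hsurj : Function.Surjective π.hom.base := fun s => (hconn s).nonempty
  -- Properness enters as closedness of `π`. The bijectivity is the first claim and also what
  -- carries the symbol map to an anchor with values in `T_S`.
  have hbij : ∀ W : Opens S, Function.Bijective (pullVF π W) := fun W =>
    ⟨pullVF_injective hsmooth hsurj W,
      pullVF_surjective hsmooth hproper.isClosedMap hconn W⟩
  refine ⟨hbij, F.uLie, F.uAnchor hA, fun _ => F.uBracket_cls, fun _ _ h => F.res_uAnchor hA h,
    fun _ _ _ hD => F.uAnchor_cls hA hD, F.pushModule,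
    F.pushLie hA hbij (hsmooth.pull_injective hsurj), ?_, fun _ _ _ => rfl,
    F.pullVF_pushAnchor hA hbij⟩
  exact fun W g s V h ψ e => F.res_uSmul_of_eq_cls le_rfl g h e
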